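/- Let $\mathbb F$ be a field of characteristic $0$ and let $\mathcal V$ be a differential algebra over $\mathbb F$, i.e. a unital commutative associative $\mathbb F$-algebra with an $\mathbb F$-linear derivation $\partial$. A $\lambda$-bracket on $\mathcal V$ is an $\mathbb F$-bilinear map $\{\cdot\,_\lambda\,\cdot\}:\mathcal V\times\mathcal V\to\mathcal V[\lambda]$ such that, for all $a,b,c\in\mathcal V$, $$\{\partial a_\lambda b\}=-\lambda\{a_\lambda b\},\quad \{a_\lambda \partial b\}=(\lambda+\partial)\{a_\lambda b\},\quad \{a_\lambda bc\}=\{a_\lambda b\}c+\{a_\lambda c\}b,$$ $$\{ab_\lambda c\}=\{a_{\lambda+x}c\}\big(\big|_{x=\partial}b\big)+\{b_{\lambda+x}c\}\big(\big|_{x=\partial}a\big),$$ where $P(\lambda+x)\big(\big|_{x=\partial}b\big)=\sum_n p_n(\lambda+\partial)^n b$ for $P(\lambda)=\sum_n p_n\lambda^n\in\mathcal V[\lambda]$ (no skewsymmetry or Jacobi identity is assumed). A pseudodifferential operator $A(\partial)=\sum_{n\le N}a_n\partial^n\in\mathcal V((\partial^{-1}))$ has symbol $A(z)=\sum_{n\le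 N}a_nz^n$; the product is given by $(A\circ B)(z)=A(z+\partial)B(z)$, with $(z+\partial)^n$ expanded in non-negative powers of $\partial$, and the formal adjoint is $A^*(\partial)=\sum_n(-\partial)^n\circ a_n$. For matrices, the product is the usual one and $(A^*)_{ij}=(A_{ji})^*$. For operators $A,B$ put $\{A(z)_\lambda B(w)\}=\sum_{m,n}\{a_m{}_\lambda b_n\}z^mw^n$. A matrix $A=(A_{ij}(\partial))\in\mathrm{Mat}_{M\times N}\mathcal V((\partial^{-1}))$ is of Adler type with respect to $\{\cdot\,_\lambda\,\cdot\}$ if for all $i,h\in\{1,\dots,M\}$ and $j,k\in\{1,\dots,N\}$ $$\{A_{ij}(z)_\lambda A_{hk}(w)\}=A_{hj}(w+\lambda+\partial)\,\iota_z(z-w-\lambda-\partial)^{-1}(A_{ik})^*(\lambda-z)-A_{hj}(z)\,\iota_z(z-w-\lambda-\partial)^{-1}A_{ik}(w),$$ where $\iota_z(z-w-\lambda-\partial)^{-1}=\sum_{k\ge0}z^{-k-1}(w+\lambda+\partial)^k$, powers $(w+\lambda+\partial)^n$ are expanded in non-negative powers of $\lambda+\partial$, and powers $(\lambda-z)^m$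 in non-negative powers of $\lambda$. **Proposition.** Let $\{\cdot\,_\lambda\,\cdot\}$ be a $\lambda$-bracket on $\mathcal V$ and let $A(\partial)\in\mathrm{Mat}_{M\times N}\mathcal V((\partial^{-1}))$ be of Adler type with respect to it. Then: (a) For all subsets $I\subset\{1,\dots,M\}$, $J\subset\{1,\dots,N\}$ the submatrix $A_{IJ}=(A_{ij})_{i\in I,j\in J}$ is of Adler type. In particular every entry $A_{ij}(\partial)$ is a scalar pseudodifferential operator of Adler type. (b) The formal adjoint $A^*(\partial)\in\mathrm{Mat}_{N\times M}\mathcal V((\partial^{-1}))$ is of Adler type (with respect to the same $\lambda$-bracket). (c) If $M=N$ and $A(\partial)$ is invertible in $\mathrm{Mat}_{N\times N}\mathcal V((\partial^{-1}))$, then $A(\partial)^{-1}$ is of Adler type with respect to the opposite $\lambda$-bracket $-\{\cdot\,_\lambda\,\cdot\}$. (d) If $B(\partial)\in\mathrm{Mat}_{N\times P}\mathcal V((\partial^{-1}))$ is also of Adler type with respect to $\{\cdot\,_\lambda\,\cdot\}$, and $\{A_{ij}(z)_\lambda B_{hk}(w)\}=0$ and $\{B_{hk}(z)_\lambda A_{ij}(w)\}=0$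 for all $i,j,h,k$, then $A(\partial)\circ B(\partial)\in\mathrm{Mat}_{M\times P}\mathcal V((\partial^{-1}))$ is of Adler type. In particular, for all constant matrices $S\in\mathrm{Mat}_{P\times M}\mathbb F$ and $T\in\mathrm{Mat}_{N\times Q}\mathbb F$, the matrix $SA(\partial)T\in\mathrm{Mat}_{P\times Q}\mathcal V((\partial^{-1}))$ is of Adler type. -/

import Mathlib

open Polynomial

noncomputable section

namespace AdlerType

/-! ### Expressions of the form `A(z + T) g(z)` -/

section Shift

variable {V W : Type*} [CommRing V] [AddCommGroup W] [Module V W]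

/-- Let `a(z) = ∑ₙ aₙ zⁿ` and `g(z) = ∑ₘ gₘ zᵐ` be formal series and let `T` be an additive operator
on the space of coefficients of `g`, commuting with `z`.  This is the series
`a(z + T) g(z) = ∑ₙ aₙ (z + T)ⁿ g(z)`, where `(z + T)ⁿ = ∑_{k ≥ 0} (n choose k) z^(n-k) Tᵏ` is
expanded in non-negative powers of `T` (also for `n < 0`).  In all the cases of interest (`a` and
`g` bounded above in `z`), the sum defining each coefficient has finitely many nonzero terms. -/
def shiftApply (T : AddMonoid.End W) (a : ℤ → V) (g : ℤ → W) : ℤ → W := fun q =>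
  ∑ᶠ x : ℤ × ℕ, a x.1 • (Ring.choose x.1 x.2 • (T ^ x.2) (g (q - x.1 + x.2)))

/-- Multiplication of a series `g(z, w)` (with `g p q` the coefficient of `z^p w^q`) by `a(z)`. -/
def mulZ (a : ℤ → V) (g : ℤ → ℤ → W) : ℤ → ℤ → W := fun p q =>
  ∑ᶠ n : ℤ, a n • g (p - n) q

/-- Multiplication of a series `g(z, w)` by the operator `w + T`. -/
def wAdd (T : AddMonoid.End W) (g : ℤ → ℤ → W) : ℤ → ℤ → W := fun p q =>
  g p (q - 1) + T (g p q)

/-- `ι_z (z - w - T)⁻¹ g(z, w) = ∑_{k ≥ 0} z^(-k-1) (w + T)ᵏ g(z, w)`, the expansion for large `z`;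
here `T` acts on the coefficients of `g`. For `g` bounded above in `z` the sum defining each
coefficient is finite. -/
def iotaInv (T : AddMonoid.End W) (g : ℤ → ℤ → W) : ℤ → ℤ → W := fun p q =>
  ∑ᶠ k : ℕ, ((wAdd T)^[k] g) (p + k + 1) q

end Shift

/-! ### Pseudodifferential operators -/

/-- The space `V((∂⁻¹))` of scalar pseudodifferential operators `∑_{n ≤ N} aₙ ∂ⁿ` over `V`, through
their symbols: an operator `a` is the family of its coefficients `a n` (those of `∂ⁿ`, written on
the right), which vanishes for `n` large enough. -/
def pseudoDiff (V : Type*) [CommRing V] : Submodule V (ℤ → V) where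
  carrier := {a | ∃ N : ℤ, ∀ n, N < n → a n = 0}
  zero_mem' := ⟨0, fun _ _ => rfl⟩
  add_mem' := by
    rintro a b ⟨N, hN⟩ ⟨M, hM⟩
    refine ⟨max N M, fun n hn => ?_⟩
    simp [hN n (lt_of_le_of_lt (le_max_left _ _) hn), hM n (lt_of_le_of_lt (le_max_right _ _) hn)]
  smul_mem' := by
    rintro c a ⟨N, hN⟩
    exact ⟨N, fun n hn => by simp [hN n hn]⟩

/-- The type of scalar pseudodifferential operators over `V`. -/
abbrev PDO (V : Type*) [CommRing V] := ↥(pseudoDiff V)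

/-- The operator of multiplication by `c ∈ V`. -/
def PDO.const {V : Type*} [CommRing V] (c : V) : PDO V :=
  ⟨fun n => if n = 0 then c else 0, 0, fun n hn => by simp [hn.ne']⟩

section Diff

variable {F V : Type*} [Field F] [CommRing V] [Algebra F V]

/-- A derivation as an additive operator on `V`. -/
def derEnd (D : Derivation F V V) : AddMonoid.End V := (D : V →ₗ[F] V).toAddMonoidHom

/-- The product `A ∘ B` of pseudodifferential operators, given in terms of symbols by
`(A ∘ B)(z) = A(z + ∂) B(z)`. -/
def PDO.comp (D : Derivation F V V) (a b : PDO V) : PDO V :=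
  ⟨shiftApply (derEnd D) a.1 b.1, by
    obtain ⟨a, N, hN⟩ := a
    obtain ⟨b, M, hM⟩ := b
    refine ⟨N + M, fun q hq => ?_⟩
    refine (finsum_congr fun x => ?_).trans finsum_zero
    by_cases hx : N < x.1
    · simp [hN _ hx]
    · have : b (q - x.1 + x.2) = 0 := hM _ (by omega)
      simp [this]⟩

/-- The formal adjoint `A* = ∑ₙ (-∂)ⁿ ∘ aₙ = ∑ₙ ∑_{k ≥ 0} (-1)ⁿ (n choose k) aₙ⁽ᵏ⁾ ∂^(n-k)`. -/
def PDO.adjoint (D : Derivation F V V) (a : PDO V) : PDO V :=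
  ⟨fun p => ∑ᶠ k : ℕ, ((p + k).negOnePow : ℤ) • (Ring.choose (p + k) k • D^[k] (a.1 (p + k))), by
    obtain ⟨a, N, hN⟩ := a
    refine ⟨N, fun p hp => ?_⟩
    refine (finsum_congr fun k => ?_).trans finsum_zero
    have : a (p + k) = 0 := hN _ (by omega)
    simp [this]⟩

/-! ### Matrix pseudodifferential operators -/

/-- The product of matrix pseudodifferential operators. -/
def matComp {m n p : Type*} [Fintype n] (D : Derivation F V V)
    (A : Matrix m n (PDO V)) (B : Matrix n p (PDO V)) : Matrix m p (PDO V) :=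
  Matrix.of fun i j => ∑ k, PDO.comp D (A i k) (B k j)

/-- The formal adjoint of a matrix pseudodifferential operator: `(A*)ᵢⱼ = (Aⱼᵢ)*`. -/
def matAdjoint {m n : Type*} (D : Derivation F V V) (A : Matrix m n (PDO V)) :
    Matrix n m (PDO V) :=
  Matrix.of fun i j => PDO.adjoint D (A j i)

/-- A matrix with entries in the base field, as a matrix pseudodifferential operator. -/
def matConst {m n : Type*} (V : Type*) [CommRing V] [Algebra F V] (S : Matrix m n F) :
    Matrix m n (PDO V) :=
  Matrix.of fun i j => PDO.const (algebraMap F V (S i j))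

/-! ### `λ`-brackets.  The variable `λ` is the variable `X` of `V[X]`. -/

/-- The operator `λ + ∂` on `V[λ]`, where `∂` acts on coefficients. -/
def lamAdd (D : Derivation F V V) : AddMonoid.End V[X] where
  toFun P := X * P + P.sum fun n c => monomial n (D c)
  map_zero' := by simp
  map_add' P Q := by
    rw [Polynomial.sum_add_index _ _ _ (by simp) (by simp), mul_add]
    abel

/-- For `P(λ) = ∑ₙ pₙ λⁿ` and `b ∈ V`, this is `P(λ + x)(|_{x=∂} b) = ∑ₙ pₙ (λ + ∂)ⁿ b`. -/
def shiftEval (D : Derivation F V V) (P : V[X]) (b : V) : V[X] :=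
  P.sum fun n c => C c * (lamAdd D ^ n) (C b)

/-- A `λ`-bracket on the differential algebra `(V, ∂)` over `F`: an `F`-bilinear map
`V × V → V[λ]` satisfying sesquilinearity and the Leibniz rules. -/
structure LambdaBracket (D : Derivation F V V) where
  /-- the bracket `{a_λ b}` -/
  br : V →ₗ[F] V →ₗ[F] V[X]
  sesq_left : ∀ a b, br (D a) b = -(X * br a b)
  sesq_right : ∀ a b, br a (D b) = lamAdd D (br a b)
  leibniz_left : ∀ a b c, br a (b * c) = br a b * C c + br a c * C b
  leibniz_right : ∀ a b c, br (a * b) c = shiftEval D (br a c) b + shiftEval D (br b c) a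

theorem shiftEval_neg (D : Derivation F V V) (P : V[X]) (b : V) :
    shiftEval D (-P) b = -shiftEval D P b := by
  simp [shiftEval, Polynomial.sum_def, Finset.sum_neg_distrib]

/-- The opposite `λ`-bracket `-{·_λ ·}`. -/
def LambdaBracket.opposite {D : Derivation F V V} (L : LambdaBracket D) : LambdaBracket D where
  br := -L.br
  sesq_left a b := by simp [L.sesq_left]
  sesq_right a b := by simp [L.sesq_right]
  leibniz_left a b c := by simp [L.leibniz_left]; ring
  leibniz_right a b c := by simp [L.leibniz_right, shiftEval_neg]; ring

/-! ### Operators of Adler type -/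

/-- The series `B(λ - z) = ∑ₘ bₘ (λ - z)ᵐ ∈ V[λ]((z⁻¹))`, where
`(λ - z)ᵐ = ∑_{l ≥ 0} (m choose l) λˡ (-z)^(m-l)`. -/
def lamSub (b : PDO V) : ℤ → V[X] := fun s =>
  ∑ᶠ l : ℕ, (s.negOnePow : ℤ) • (Ring.choose (s + l) l • (C (b.1 (s + l)) * X ^ l))

/-- A series in `z`, as a series in `z` and `w`. -/
def inZ {W : Type*} [Zero W] (g : ℤ → W) : ℤ → ℤ → W := fun p q => if q = 0 then g p else 0

/-- A series in `w`, as a series in `z` and `w`. -/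
def inW {W : Type*} [Zero W] (g : ℤ → W) : ℤ → ℤ → W := fun p q => if p = 0 then g q else 0

/-- For scalar operators `a`, `b`, the series
`a(w+λ+∂) ι_z(z-w-λ-∂)⁻¹ b*(λ-z) - a(z) ι_z(z-w-λ-∂)⁻¹ b(w)`
in `z, w` with coefficients in `V[λ]`. -/
def adlerRHS (D : Derivation F V V) (a b : PDO V) : ℤ → ℤ → V[X] := fun p q =>
  shiftApply (lamAdd D) a.1
      (iotaInv (lamAdd D) (inZ (lamSub (PDO.adjoint D b))) p) q
    - mulZ a.1 (iotaInv (lamAdd D) (inW fun r => C (b.1 r))) p q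

/-- For scalar operators `a`, `b`, the series `{a(z)_λ b(w)} = ∑ₚ,ᵩ {aₚ _λ bᵩ} z^p w^q`. -/
def LambdaBracket.series {D : Derivation F V V} (L : LambdaBracket D) (a b : PDO V) :
    ℤ → ℤ → V[X] := fun p q =>
  L.br (a.1 p) (b.1 q)

/-- A matrix pseudodifferential operator `A` is of Adler type with respect to the `λ`-bracket `L` if
`{Aᵢⱼ(z)_λ Aₕₖ(w)} = Aₕⱼ(w+λ+∂) ι_z(z-w-λ-∂)⁻¹ (Aᵢₖ)*(λ-z) - Aₕⱼ(z) ι_z(z-w-λ-∂)⁻¹ Aᵢₖ(w)`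
for all `i, j, h, k`. -/
def IsAdler {m n : Type*} {D : Derivation F V V} (L : LambdaBracket D)
    (A : Matrix m n (PDO V)) : Prop :=
  ∀ (i : m) (j : n) (h : m) (k : n),
    L.series (A i j) (A h k) = adlerRHS D (A h j) (A i k)

end Diff

end AdlerType

end

open Polynomial

noncomputable section

namespace AdlerType

/-! ### Laurent series in `z⁻¹` -/

/-! The key is to read a polynomial `∑ pₙ λⁿ` as the operator `∑ pₙ (λ+∂)ⁿ` on `V[λ]` (`polyOp`).
This map is injective, because applying the operator to `1` returns the polynomial. Put `t = λ+∂`,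
so that `t a = a t + ∂a`. Multiplying a polynomial by `λ` becomes right multiplication by `t`,
acting by `λ+∂` becomes left multiplication by `t`, and the substitution `λ ↦ λ+x`, `x = ∂` on `b`,
becomes right multiplication by `b`. The bracket thus takes values in a noncommutative ring `E` and
obeys plain Leibniz rules (`RingBracket`), and the Adler condition becomes an identity between
products of double series over `E`, with `z` the outer and `w` the inner variable: `{A_ij(z),
A_hk(w)} = A_hj(w+t) (z-w-t)⁻¹ A_ik*(t-z) - A_hj(z) (z-w-t)⁻¹ A_ik(w)`.

Three facts carry the argument. The symbol `A(w+t)` is multiplicative for composition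
(`leftSymbol_opComp`). The symbol `A*(t-z) = ∑ (z-t)ⁿ aₙ` reverses products (`dagger_opComp`). The
bracket with a composition splits into a term multiplied by such a symbol and a term in which the
other factor is substituted (`lmap_opComp_left`, `lmap_opComp_right`); these substitutions commute
with `A(w+t)` on the left, with `A*(t-z)` on the right and with `(z-w-t)⁻¹`.

Products: the Leibniz rules turn the bracket of `A∘B` with itself into a sum of two Adler
expressions, whose unwanted middle terms cancel after exchanging the summation indices. Inverses:
differentiating `A∘A⁻¹ = 1` in each slot expresses the bracket of the inverse through that of `A`,
and the sums telescope to minus the Adler expression. Adjoints: bracketing adjoints amounts to `z ↦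
t-z`, `w ↦ -w-t`, an involution that exchanges the two terms of the Adler expression up to sign
(`reflect₂_adlerSer`). Submatrices only restrict indices, and constant matrices are of Adler type
because both sides vanish.

Identities for integer powers, negative ones included, come from uniqueness for the recursion `f
(n+1) = (z+T) f n`; identities linear in a series come from bounded maps agreeing on monomials. -/

/-- Formal series `∑ₙ fₙ zⁿ` with coefficients bounded above, as Hahn series in `z⁻¹`. -/
abbrev Laurent (W : Type*) [Zero W] := HahnSeries ℤ W

section Basic

variable {W W' W'' : Type*} [AddCommGroup W] [AddCommGroup W'] [AddCommGroup W'']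

/-- The coefficient of `z^q`. -/
def coef (f : Laurent W) (q : ℤ) : W := f.coeff (-q)

theorem coef_ext {f g : Laurent W} (h : ∀ q, coef f q = coef g q) : f = g := by
  ext q
  simpa [coef] using h (-q)

@[simp] theorem coef_zero (q : ℤ) : coef (0 : Laurent W) q = 0 := rfl

@[simp] theorem coef_add (f g : Laurent W) (q : ℤ) : coef (f + g) q = coef f q + coef g q := rfl

@[simp] theorem coef_neg (f : Laurent W) (q : ℤ) : coef (-f) q = -coef f q := rfl

@[simp] theorem coef_sub (f g : Laurent W) (q : ℤ) : coef (f - g) q = coef f q - coef g q := rfl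

/-- The coefficient of `z^q`, as an additive map. -/
def coefHom (q : ℤ) : Laurent W →+ W where
  toFun f := coef f q
  map_zero' := rfl
  map_add' _ _ := rfl

theorem coef_sum {ι : Type*} (s : Finset ι) (f : ι → Laurent W) (q : ℤ) :
    coef (∑ i ∈ s, f i) q = ∑ i ∈ s, coef (f i) q :=
  map_sum (coefHom q) f s

@[simp] theorem coef_zsmul (m : ℤ) (f : Laurent W) (q : ℤ) : coef (m • f) q = m • coef f q :=
  map_zsmul (coefHom q) m f

theorem exists_coef_eq_zero (f : Laurent W) : ∃ N : ℤ, ∀ n, N < n → coef f n = 0 := by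
  by_cases hf : f = 0
  · exact ⟨0, fun n _ => by simp [hf]⟩
  · refine ⟨-f.order, fun n hn => HahnSeries.coeff_eq_zero_of_lt_order (by omega)⟩

/-- The series with given coefficients. -/
def ofCoef (a : ℤ → W) (h : ∃ N : ℤ, ∀ n, N < n → a n = 0) : Laurent W :=
  HahnSeries.ofSuppBddBelow (fun n => a (-n)) (by
    obtain ⟨N, hN⟩ := h
    refine ⟨-N, fun n hn => ?_⟩
    by_contra hlt
    exact hn (hN _ (by omega)))

@[simp] theorem coef_ofCoef (a : ℤ → W) (h) (q : ℤ) : coef (ofCoef a h) q = a q := by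
  simp [coef, ofCoef]

/-- The monomial `e zⁿ`. -/
def mono (n : ℤ) (e : W) : Laurent W := HahnSeries.single (-n) e

theorem coef_mono (n : ℤ) (e : W) (q : ℤ) : coef (mono n e) q = if q = n then e else 0 := by
  simp [coef, mono, HahnSeries.coeff_single]

@[simp] theorem coef_mono_self (n : ℤ) (e : W) : coef (mono n e) n = e := by simp [coef_mono]

theorem coef_mono_of_ne {n q : ℤ} (h : q ≠ n) (e : W) : coef (mono n e) q = 0 := by
  simp [coef_mono, h]

@[simp] theorem mono_zero (n : ℤ) : mono n (0 : W) = 0 := by simp [mono]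

theorem mono_add (n : ℤ) (a b : W) : mono n (a + b) = mono n a + mono n b :=
  coef_ext fun q => by simp only [coef_mono, coef_add]; split_ifs <;> simp

/-- Multiplication by `z`. -/
def shift : Laurent W →+ Laurent W where
  toFun f := ofCoef (fun q => coef f (q - 1)) (by
    obtain ⟨N, hN⟩ := exists_coef_eq_zero f
    exact ⟨N + 1, fun n hn => hN _ (by omega)⟩)
  map_zero' := coef_ext fun q => by simp
  map_add' f g := coef_ext fun q => by simp

@[simp] theorem coef_shift (f : Laurent W) (q : ℤ) : coef (shift f) q = coef f (q - 1) := by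
  simp [shift]

theorem shift_mono (n : ℤ) (e : W) : shift (mono n e) = mono (n + 1) e :=
  coef_ext fun q => by simp only [coef_shift, coef_mono]; congr 1; ext; omega

/-- An additive map applied to all coefficients. -/
def lmap (η : W →+ W') : Laurent W →+ Laurent W' where
  toFun f := ofCoef (fun q => η (coef f q)) (by
    obtain ⟨N, hN⟩ := exists_coef_eq_zero f
    exact ⟨N, fun n hn => by simp [hN n hn]⟩)
  map_zero' := coef_ext fun q => by simp
  map_add' f g := coef_ext fun q => by simp

@[simp] theorem coef_lmap (η : W →+ W') (f : Laurent W) (q : ℤ) :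
    coef (lmap η f) q = η (coef f q) := by
  simp [lmap]

theorem lmap_mono (η : W →+ W') (n : ℤ) (e : W) : lmap η (mono n e) = mono n (η e) :=
  coef_ext fun q => by simp only [coef_lmap, coef_mono]; split_ifs <;> simp

theorem lmap_shift (η : W →+ W') (f : Laurent W) : lmap η (shift f) = shift (lmap η f) :=
  coef_ext fun q => by simp

theorem lmap_lmap (η' : W' →+ W'') (η : W →+ W') (f : Laurent W) :
    lmap η' (lmap η f) = lmap (η'.comp η) f :=
  coef_ext fun q => by simp

/-! ### Bounded additive maps -/

/-- An additive map between spaces of series that raises degrees by a bounded amount. -/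
structure IsBounded (F : Laurent W → Laurent W') : Prop where
  map_add : ∀ f g, F (f + g) = F f + F g
  bound : ∃ c : ℤ, ∀ (f : Laurent W) (N : ℤ), (∀ n, N < n → coef f n = 0) →
    ∀ n, N + c < n → coef (F f) n = 0

namespace IsBounded

theorem id : IsBounded fun f : Laurent W => f :=
  ⟨fun _ _ => rfl, 0, fun _ _ h n hn => h n (by omega)⟩

theorem comp {F : Laurent W' → Laurent W''} {G : Laurent W → Laurent W'} (hF : IsBounded F)
    (hG : IsBounded G) : IsBounded fun f => F (G f) := by
  obtain ⟨hF, c, hc⟩ := hF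
  obtain ⟨hG, d, hd⟩ := hG
  exact ⟨fun f g => by rw [hG, hF], d + c, fun f N h n hn => hc _ _ (hd f N h) n (by omega)⟩

theorem add {F G : Laurent W → Laurent W'} (hF : IsBounded F) (hG : IsBounded G) :
    IsBounded fun f => F f + G f := by
  obtain ⟨hF, c, hc⟩ := hF
  obtain ⟨hG, d, hd⟩ := hG
  refine ⟨fun f g => by rw [hG, hF]; abel, max c d, fun f N h n hn => ?_⟩
  have := le_max_left c d
  have := le_max_right c d
  rw [coef_add, hc f N h n (by omega), hd f N h n (by omega), add_zero]

theorem neg {F : Laurent W → Laurent W'} (hF : IsBounded F) : IsBounded fun f => -F f := by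
  obtain ⟨hF, c, hc⟩ := hF
  exact ⟨fun f g => by rw [hF]; abel, c, fun f N h n hn => by rw [coef_neg, hc f N h n hn, neg_zero]⟩

theorem sub {F G : Laurent W → Laurent W'} (hF : IsBounded F) (hG : IsBounded G) :
    IsBounded fun f => F f - G f := by
  simpa only [sub_eq_add_neg] using hF.add hG.neg

theorem map_zero {F : Laurent W → Laurent W'} (hF : IsBounded F) : F 0 = 0 := by
  simpa using hF.map_add 0 0

/-- A bounded map as an additive homomorphism. -/
def toHom {F : Laurent W → Laurent W'} (hF : IsBounded F) : Laurent W →+ Laurent W' :=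
  ⟨⟨F, hF.map_zero⟩, hF.map_add⟩

/-- Bounded maps are determined by their values on monomials. -/
theorem ext {F G : Laurent W → Laurent W'} (hF : IsBounded F) (hG : IsBounded G)
    (h : ∀ n e, F (mono n e) = G (mono n e)) (f : Laurent W) : F f = G f := by
  have hH := hF.sub hG
  rw [← sub_eq_zero]
  refine coef_ext fun q => ?_
  obtain ⟨c, hc⟩ := hH.bound
  obtain ⟨N, hN⟩ := exists_coef_eq_zero f
  -- The map raises degrees by at most `c`, so terms of degree below `q - c` cannot reach `z^q`,
  -- while terms above `N` vanish. Only this finite part matters, and additivity suffices for it.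
  set P : Laurent W := ∑ n ∈ Finset.Icc (q - c) N, mono n (coef f n) with hP
  have hrest : ∀ n, q - c - 1 < n → coef (f - P) n = 0 := by
    intro n hn
    rw [coef_sub, hP, coef_sum]
    simp only [coef_mono, Finset.sum_ite_eq, Finset.mem_Icc]
    split_ifs with h1
    · simp
    · rw [hN n (by omega), sub_zero]
  have h0 := hc _ _ hrest q (by omega)
  have hPz : hH.toHom P = 0 := by
    rw [hP, map_sum]
    exact Finset.sum_eq_zero fun n _ => sub_eq_zero.2 (h n _)
  have : hH.toHom f = hH.toHom (f - P) := by rw [map_sub, hPz, sub_zero]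
  rw [coef_zero]
  exact (congrArg (coef · q) this).trans h0

theorem lmap (η : W →+ W') : IsBounded (lmap η) :=
  ⟨_root_.map_add _, 0, fun f N h n hn => by simp [h n (by omega)]⟩

theorem shift : IsBounded (shift (W := W)) :=
  ⟨_root_.map_add _, 1, fun f N h n hn => by simp [h (n - 1) (by omega)]⟩

end IsBounded

/-- `∑ₙ φₙ(fₙ)`, where the degree of `φₙ` is at most `n + c`. -/
def sumMap (φ : ℤ → W →+ Laurent W') (hφ : ∃ c : ℤ, ∀ n e q, n + c < q → coef (φ n e) q = 0) :
    Laurent W →+ Laurent W' where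
  toFun f := ofCoef (fun q => ∑ᶠ n, coef (φ n (coef f n)) q) (by
    obtain ⟨N, hN⟩ := exists_coef_eq_zero f
    obtain ⟨c, hc⟩ := hφ
    refine ⟨N + c, fun q hq => (finsum_congr fun n => ?_).trans finsum_zero⟩
    by_cases hn : N < n
    · simp [hN n hn]
    · exact hc _ _ _ (by omega))
  map_zero' := coef_ext fun q => by simp
  map_add' f g := coef_ext fun q => by
    obtain ⟨c, hc⟩ := hφ
    have key : ∀ f : Laurent W, (Function.support fun n => coef (φ n (coef f n)) q).Finite := by
      intro f
      obtain ⟨N, hN⟩ := exists_coef_eq_zero f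
      refine (Set.finite_Icc (q - c) N).subset fun n hn => ?_
      by_contra h
      refine hn ?_
      by_cases hn : N < n
      · simp [hN n hn]
      · exact hc _ _ _ (by simp at h; by_contra; omega)
    simp only [coef_ofCoef, coef_add, map_add]
    exact finsum_add_distrib (key f) (key g)

theorem coef_sumMap (φ : ℤ → W →+ Laurent W') (hφ) (f : Laurent W) (q : ℤ) :
    coef (sumMap φ hφ f) q = ∑ᶠ n, coef (φ n (coef f n)) q := by
  simp [sumMap]

theorem sumMap_mono (φ : ℤ → W →+ Laurent W') (hφ) (n : ℤ) (e : W) :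
    sumMap φ hφ (mono n e) = φ n e := by
  refine coef_ext fun q => ?_
  rw [coef_sumMap, finsum_eq_single _ n]
  · simp
  · intro m hm
    simp [coef_mono_of_ne hm]

theorem IsBounded.sumMap (φ : ℤ → W →+ Laurent W') (hφ) : IsBounded (sumMap φ hφ) := by
  refine ⟨_root_.map_add _, ?_⟩
  obtain ⟨c, hc⟩ := hφ
  refine ⟨c, fun f N hN q hq => ?_⟩
  rw [coef_sumMap]
  refine (finsum_congr fun n => ?_).trans finsum_zero
  by_cases hn : N < n
  · simp [hN n hn]
  · exact hc _ _ _ (by omega)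

end Basic

/-! ### Multiplication of Laurent series over a ring -/

section Ring

variable {E E' : Type*} [Ring E] [Ring E']

theorem coef_mul (x y : Laurent E) (m : ℤ) :
    coef (x * y) m = ∑ᶠ n, coef x n * coef y (m - n) := by
  classical
  rw [coef, HahnSeries.coeff_mul]
  set A := Finset.antidiagonal x.isPWO_support y.isPWO_support (-m) with hA
  have hinj : Set.InjOn (fun p : ℤ × ℤ => -p.1) A := by
    intro p hp r hr h
    simp only [hA, SetLike.mem_coe, Finset.mem_antidiagonal] at hp hr
    ext <;> simp at h <;> omega
  rw [finsum_eq_sum_of_support_subset (s := A.image fun p => -p.1), Finset.sum_image hinj]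
  · refine Finset.sum_congr rfl fun p hp => ?_
    simp only [hA, Finset.mem_antidiagonal] at hp
    simp only [coef]
    congr 2 <;> omega
  · intro n hn
    simp only [Finset.coe_image, Set.mem_image, SetLike.mem_coe, hA, Finset.mem_antidiagonal]
    refine ⟨(-n, -m + n), ⟨left_ne_zero_of_mul hn, ?_, by ring⟩, by simp⟩
    have := right_ne_zero_of_mul hn
    simpa [coef, sub_eq_add_neg, add_comm] using this

/-- A constant series. -/
def lconst : E →+* Laurent E := HahnSeries.C

theorem lconst_eq_mono (e : E) : lconst e = mono 0 e := by
  simp [mono, lconst, HahnSeries.C_apply]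

theorem coef_lconst (e : E) (q : ℤ) : coef (lconst e) q = if q = 0 then e else 0 := by
  rw [lconst_eq_mono, coef_mono]

theorem coef_one (q : ℤ) : coef (1 : Laurent E) q = if q = 0 then 1 else 0 := by
  rw [← map_one lconst, coef_lconst]

@[simp] theorem coef_lconst_mul (e : E) (f : Laurent E) (q : ℤ) :
    coef (lconst e * f) q = e * coef f q := by
  rw [coef_mul, finsum_eq_single _ 0]
  · simp [coef_lconst]
  · intro n hn
    simp [coef_lconst, hn]

@[simp] theorem coef_mul_lconst (e : E) (f : Laurent E) (q : ℤ) :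
    coef (f * lconst e) q = coef f q * e := by
  rw [coef_mul, finsum_eq_single _ q]
  · simp [coef_lconst]
  · intro n hn
    rw [coef_lconst, if_neg (by omega), mul_zero]

/-- The variable `z`. -/
def zvar : Laurent E := mono 1 1

@[simp] theorem zvar_mul (f : Laurent E) : zvar * f = shift f := by
  refine coef_ext fun q => ?_
  rw [coef_mul, finsum_eq_single _ 1]
  · simp [zvar]
  · intro n hn
    simp [zvar, coef_mono_of_ne hn]

theorem mul_zvar (f : Laurent E) : f * zvar = zvar * f := by
  refine coef_ext fun q => ?_
  rw [zvar_mul, coef_shift, coef_mul, finsum_eq_single _ (q - 1)]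
  · simp [zvar]
  · intro n hn
    rw [zvar, coef_mono_of_ne (by omega), mul_zero]

theorem mul_bound {x y : Laurent E} {N M : ℤ} (hN : ∀ n, N < n → coef x n = 0)
    (hM : ∀ n, M < n → coef y n = 0) (q : ℤ) (hq : N + M < q) : coef (x * y) q = 0 := by
  rw [coef_mul]
  refine (finsum_congr fun n => ?_).trans finsum_zero
  by_cases hn : N < n
  · simp [hN n hn]
  · simp [hM (q - n) (by omega)]

theorem IsBounded.mulLeft (y : Laurent E) : IsBounded fun f => y * f := by
  obtain ⟨M, hM⟩ := exists_coef_eq_zero y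
  exact ⟨mul_add y, M, fun f N hN n hn => mul_bound hM hN n (by omega)⟩

theorem IsBounded.mulRight (y : Laurent E) : IsBounded fun f => f * y := by
  obtain ⟨M, hM⟩ := exists_coef_eq_zero y
  exact ⟨fun f g => add_mul f g y, M, fun f N hN n hn => mul_bound hN hM n (by omega)⟩

end Ring

/-! ### Powers of `z + T` -/

section ShiftPow

variable {W W' : Type*} [AddCommGroup W] [AddCommGroup W']

/-- An additive endomorphism as an additive map. -/
def endHom (T : AddMonoid.End W) : W →+ W := T

@[simp] theorem endHom_apply (T : AddMonoid.End W) (x : W) : endHom T x = T x := rfl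

theorem end_mul_apply (S T : AddMonoid.End W) (x : W) : (S * T) x = S (T x) := rfl

/-- The operator `z + T`. -/
def addVar (T : AddMonoid.End W) : Laurent W →+ Laurent W := shift + lmap (endHom T)

theorem addVar_apply (T : AddMonoid.End W) (f : Laurent W) :
    addVar T f = shift f + lmap (endHom T) f := rfl

@[simp] theorem coef_addVar (T : AddMonoid.End W) (f : Laurent W) (q : ℤ) :
    coef (addVar T f) q = coef f (q - 1) + T (coef f q) := by
  simp [addVar_apply]

theorem IsBounded.addVar (T : AddMonoid.End W) : IsBounded (addVar T) :=
  IsBounded.shift.add (IsBounded.lmap (endHom T))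

theorem addVar_mono (T : AddMonoid.End W) (n : ℤ) (e : W) :
    addVar T (mono n e) = mono (n + 1) e + mono n (T e) := by
  rw [addVar_apply, shift_mono, lmap_mono, endHom_apply]

/-- If `(z + T) f = 0`, then `fₙ = -T fₙ₊₁` for every `n`; starting above the top degree, all
coefficients vanish by descent. -/
theorem addVar_injective (T : AddMonoid.End W) : Function.Injective (addVar T) := by
  rw [injective_iff_map_eq_zero]
  intro f hf
  obtain ⟨N, hN⟩ := exists_coef_eq_zero f
  have key : ∀ k : ℕ, ∀ n, N - k < n → coef f n = 0 := by
    intro k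
    induction k with
    | zero => intro n hn; exact hN n (by simpa using hn)
    | succ k ih =>
      intro n hn
      have h := congrArg (coef · (n + 1)) hf
      simp only [coef_addVar, ih (n + 1) (by push_cast at hn; omega), map_zero, add_zero, coef_zero,
        add_sub_cancel_right] at h
      exact h
  exact coef_ext fun n => key (N - n + 1).toNat n (by omega)

/-- Upwards the recursion itself determines the sequence, downwards injectivity of `z + T` does.
Hence negative powers need no binomial computation. -/
theorem eq_of_addVar_rec (T : AddMonoid.End W) {f g : ℤ → Laurent W} (h0 : f 0 = g 0)
    (hf : ∀ n, f (n + 1) = addVar T (f n)) (hg : ∀ n, g (n + 1) = addVar T (g n)) (n : ℤ) :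
    f n = g n := by
  induction n using Int.induction_on with
  | zero => exact h0
  | succ n ih => rw [hf, hg, ih]
  | pred n ih =>
    apply addVar_injective T
    rw [← hf, ← hg, sub_add_cancel, ih]

theorem coef_shiftPow_aux (T : AddMonoid.End W) (n : ℤ) {f : Laurent W} {N : ℤ}
    (hN : ∀ n, N < n → coef f n = 0) (q : ℤ) (M : ℕ) (hM : N < q - n + M) :
    ∑ᶠ k : ℕ, Ring.choose n k • (T ^ k) (coef f (q - n + k)) =
      ∑ k ∈ Finset.range M, Ring.choose n k • (T ^ k) (coef f (q - n + k)) := by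
  refine finsum_eq_sum_of_support_subset _ fun k hk => ?_
  by_contra hlt
  refine hk ?_
  simp only [Finset.coe_range, Set.mem_Iio, not_lt] at hlt
  simp [hN (q - n + k) (by omega)]

/-- `(z + T)ⁿ f`, where `(z + T)ⁿ` is expanded in non-negative powers of `T`. -/
def shiftPow (T : AddMonoid.End W) (n : ℤ) : Laurent W →+ Laurent W where
  toFun f := ofCoef (fun q => ∑ᶠ k : ℕ, Ring.choose n k • (T ^ k) (coef f (q - n + k))) (by
    obtain ⟨N, hN⟩ := exists_coef_eq_zero f
    refine ⟨N + n, fun q hq => ?_⟩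
    rw [coef_shiftPow_aux T n hN q 0 (by simp; omega)]
    simp)
  map_zero' := coef_ext fun q => by simp
  map_add' f g := coef_ext fun q => by
    obtain ⟨N, hN⟩ := exists_coef_eq_zero f
    obtain ⟨M, hM⟩ := exists_coef_eq_zero g
    have h1 := le_max_left N M
    have h2 := le_max_right N M
    have h3 : ∀ m, max N M < m → coef f m = 0 := fun m hm => hN m (by omega)
    have h4 : ∀ m, max N M < m → coef g m = 0 := fun m hm => hM m (by omega)
    have h5 : ∀ m, max N M < m → coef (f + g) m = 0 := fun m hm => by simp [h3 m hm, h4 m hm]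
    have h6 : max N M < q - n + ((max N M - (q - n) + 1).toNat : ℕ) := by omega
    rw [coef_add, coef_ofCoef, coef_ofCoef, coef_ofCoef, coef_shiftPow_aux T n h3 q _ h6,
      coef_shiftPow_aux T n h4 q _ h6, coef_shiftPow_aux T n h5 q _ h6, ← Finset.sum_add_distrib]
    simp

theorem coef_shiftPow (T : AddMonoid.End W) (n : ℤ) (f : Laurent W) (q : ℤ) :
    coef (shiftPow T n f) q = ∑ᶠ k : ℕ, Ring.choose n k • (T ^ k) (coef f (q - n + k)) := by
  simp [shiftPow]

theorem coef_shiftPow_eq_sum (T : AddMonoid.End W) (n : ℤ) {f : Laurent W} {N : ℤ}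
    (hN : ∀ n, N < n → coef f n = 0) (q : ℤ) (M : ℕ) (hM : N < q - n + M) :
    coef (shiftPow T n f) q =
      ∑ k ∈ Finset.range M, Ring.choose n k • (T ^ k) (coef f (q - n + k)) := by
  rw [coef_shiftPow, coef_shiftPow_aux T n hN q M hM]

theorem shiftPow_bound (T : AddMonoid.End W) (n : ℤ) {f : Laurent W} {N : ℤ}
    (hN : ∀ n, N < n → coef f n = 0) (q : ℤ) (hq : n + N < q) : coef (shiftPow T n f) q = 0 := by
  rw [coef_shiftPow_eq_sum T n hN q 0 (by simp; omega)]
  simp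

theorem shiftPow_zero (T : AddMonoid.End W) (f : Laurent W) : shiftPow T 0 f = f := by
  refine coef_ext fun q => ?_
  rw [coef_shiftPow, finsum_eq_single _ 0]
  · simp
  · intro k hk
    rw [Ring.choose_zero_pos ℤ (Nat.pos_of_ne_zero hk), zero_smul]

/-- This is Pascal's rule for `Ring.choose`, which also holds for negative upper index. -/
theorem shiftPow_add_one (T : AddMonoid.End W) (n : ℤ) (f : Laurent W) :
    shiftPow T (n + 1) f = addVar T (shiftPow T n f) := by
  refine coef_ext fun q => ?_
  obtain ⟨N, hN⟩ := exists_coef_eq_zero f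
  set M := (N - (q - n) + 1).toNat with hM
  -- Two sums are cut at `M + 1` and the one under `T` at `M`: once the `k = 0` terms are split off,
  -- all three run over the same range, the extra `T` accounting for the index shift.
  rw [coef_addVar, coef_shiftPow_eq_sum T (n + 1) hN q (M + 1) (by push_cast; omega),
    coef_shiftPow_eq_sum T n hN (q - 1) (M + 1) (by push_cast; omega),
    coef_shiftPow_eq_sum T n hN q M (by omega), Finset.sum_range_succ', Finset.sum_range_succ',
    map_sum, add_right_comm, ← Finset.sum_add_distrib]
  congr 1
  · refine Finset.sum_congr rfl fun k _ => ?_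
    rw [Ring.choose_succ_succ, map_zsmul, add_smul, add_comm, pow_succ' T k]
    congr 1
    · congr 3; ring
    · simp only [end_mul_apply]
      congr 4; push_cast; ring
  · simp only [Ring.choose_zero_right, one_smul, pow_zero]
    congr 2; push_cast; ring

/-- Used to recognise a family as `(z + T)ⁿ` applied to its initial value: only one step of the
recursion has to be verified. -/
theorem eq_shiftPow (T : AddMonoid.End W) {f : ℤ → Laurent W}
    (hf : ∀ n, f (n + 1) = addVar T (f n)) (n : ℤ) : f n = shiftPow T n (f 0) :=
  eq_of_addVar_rec T (g := fun n => shiftPow T n (f 0)) (shiftPow_zero T _).symm hf (fun n => shiftPow_add_one T n _) n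

theorem lmap_addVar {T : AddMonoid.End W} {T' : AddMonoid.End W'} {η : W →+ W'}
    (h : ∀ x, η (T x) = T' (η x)) (f : Laurent W) :
    lmap η (addVar T f) = addVar T' (lmap η f) :=
  coef_ext fun q => by simp [h]

theorem lmap_shiftPow {T : AddMonoid.End W} {T' : AddMonoid.End W'} {η : W →+ W'}
    (h : ∀ x, η (T x) = T' (η x)) (n : ℤ) (f : Laurent W) :
    lmap η (shiftPow T n f) = shiftPow T' n (lmap η f) := by
  have := eq_shiftPow T' (f := fun n => lmap η (shiftPow T n f))
    (fun n => by rw [shiftPow_add_one, lmap_addVar h]) n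
  simpa only [shiftPow_zero] using this

/-! ### The reflection `z ↦ -z - T` -/

/-- `∑ₙ (-z-T)ⁿ fₙ`. -/
def reflect (T : AddMonoid.End W) : Laurent W →+ Laurent W :=
  sumMap (fun n => (n.negOnePow : ℤ) • (shiftPow T n).comp
    ⟨⟨mono 0, mono_zero 0⟩, mono_add 0⟩) ⟨0, fun n e q hq => by
      have : coef (shiftPow T n (mono 0 e)) q = 0 :=
        shiftPow_bound T n (fun m hm => coef_mono_of_ne (by omega) e) q hq
      simp [this]⟩

theorem reflect_mono (T : AddMonoid.End W) (n : ℤ) (e : W) :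
    reflect T (mono n e) = (n.negOnePow : ℤ) • shiftPow T n (mono 0 e) := by
  simp [reflect, sumMap_mono]

theorem coef_reflect (T : AddMonoid.End W) (f : Laurent W) (q : ℤ) :
    coef (reflect T f) q =
      ∑ᶠ n : ℤ, (n.negOnePow : ℤ) • coef (shiftPow T n (mono 0 (coef f n))) q := by
  rw [reflect, coef_sumMap]
  simp

theorem IsBounded.reflect (T : AddMonoid.End W) : IsBounded (reflect T) := IsBounded.sumMap _ _

theorem reflect_mono_zero (T : AddMonoid.End W) (e : W) : reflect T (mono 0 e) = mono 0 e := by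
  rw [reflect_mono, shiftPow_zero]; simp

theorem negOnePow_add_one_smul (n : ℤ) (x : W) :
    ((n + 1).negOnePow : ℤ) • x = -((n.negOnePow : ℤ) • x) := by
  simp [Int.negOnePow_succ]

theorem reflect_shift (T : AddMonoid.End W) (f : Laurent W) :
    reflect T (shift f) = -addVar T (reflect T f) := by
  refine IsBounded.ext ((IsBounded.reflect T).comp .shift)
    (((IsBounded.addVar T).comp (.reflect T)).neg) (fun n e => ?_) f
  rw [shift_mono, reflect_mono, reflect_mono, negOnePow_add_one_smul, shiftPow_add_one, map_zsmul]

theorem lmap_reflect {T : AddMonoid.End W} {T' : AddMonoid.End W'} {η : W →+ W'}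
    (h : ∀ x, η (T x) = T' (η x)) (f : Laurent W) :
    lmap η (reflect T f) = reflect T' (lmap η f) := by
  refine IsBounded.ext ((IsBounded.lmap η).comp (.reflect T))
    ((IsBounded.reflect T').comp (.lmap η)) (fun n e => ?_) f
  rw [lmap_mono, reflect_mono, reflect_mono, map_zsmul, lmap_shiftPow h, lmap_mono]

theorem reflect_addVar (T : AddMonoid.End W) (f : Laurent W) :
    reflect T (addVar T f) = -shift (reflect T f) := by
  rw [addVar_apply, map_add, reflect_shift, ← lmap_reflect (T := T) (T' := T) (η := endHom T) fun _ => rfl,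
    addVar_apply]
  abel

/-- The reflection exchanges multiplication by `z` with that by `-(z + T)`, so its square commutes
with `z`; it also fixes constants. -/
theorem reflect_reflect (T : AddMonoid.End W) (f : Laurent W) : reflect T (reflect T f) = f := by
  refine IsBounded.ext ((IsBounded.reflect T).comp (.reflect T)) .id (fun n e => ?_) f
  -- With `T = 0` the recursion is multiplication by `z`, so the uniqueness principle covers
  -- monomials of every integer degree.
  have h0 : ∀ f : Laurent W, addVar (0 : AddMonoid.End W) f = shift f := fun f =>
    coef_ext fun q => by simp
  refine eq_of_addVar_rec (0 : AddMonoid.End W)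
    (f := fun n => reflect T (reflect T (mono n e))) (g := fun n => mono n e) ?_ ?_ ?_ n
  · simp only [reflect_mono_zero]
  · intro n
    rw [h0, ← shift_mono, reflect_shift, map_neg, reflect_addVar, neg_neg]
  · intro n
    rw [h0, shift_mono]

end ShiftPow

/-! ### Multiplication operators and the powers `(z + t)ⁿ` -/

section Ring

variable {E : Type*} [Ring E]

/-- Left multiplication as an additive operator. -/
def mulL (t : E) : AddMonoid.End E := AddMonoidHom.mulLeft t

@[simp] theorem mulL_apply (t x : E) : mulL t x = t * x := rfl

/-- Right multiplication as an additive operator. -/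
def mulR (t : E) : AddMonoid.End E := AddMonoidHom.mulRight t

@[simp] theorem mulR_apply (t x : E) : mulR t x = x * t := rfl

theorem mulL_pow_apply (t : E) (k : ℕ) (x : E) : (mulL t ^ k) x = t ^ k * x := by
  induction k generalizing x with
  | zero => simp
  | succ k ih => rw [pow_succ, end_mul_apply, ih, pow_succ, mul_assoc, mulL_apply]

theorem mulR_pow_apply (t : E) (k : ℕ) (x : E) : (mulR t ^ k) x = x * t ^ k := by
  induction k generalizing x with
  | zero => simp
  | succ k ih => rw [pow_succ, end_mul_apply, ih, pow_succ', ← mul_assoc, mulR_apply]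

theorem lmap_mulL (t : E) (f : Laurent E) : lmap (endHom (mulL t)) f = lconst t * f :=
  coef_ext fun q => by simp

theorem lmap_mulR (t : E) (f : Laurent E) : lmap (endHom (mulR t)) f = f * lconst t :=
  coef_ext fun q => by simp

theorem addVar_mulL (t : E) (f : Laurent E) : addVar (mulL t) f = (zvar + lconst t) * f := by
  rw [addVar_apply, add_mul, zvar_mul, lmap_mulL]

theorem addVar_mulR (t : E) (f : Laurent E) : addVar (mulR t) f = f * (zvar + lconst t) := by
  rw [addVar_apply, mul_add, mul_zvar, zvar_mul, lmap_mulR]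

/-- The series `(z + t)ⁿ`. -/
def zpowAdd (t : E) (n : ℤ) : Laurent E := shiftPow (mulL t) n 1

theorem zpowAdd_zero (t : E) : zpowAdd t 0 = 1 := shiftPow_zero _ _

theorem zpowAdd_add_one (t : E) (n : ℤ) :
    zpowAdd t (n + 1) = (zvar + lconst t) * zpowAdd t n := by
  rw [zpowAdd, shiftPow_add_one, addVar_mulL, ← zpowAdd]

/-- Only powers of `t` applied to `0` or `1` occur, so the side of multiplication is immaterial. -/
theorem zpowAdd_eq (t : E) (n : ℤ) : zpowAdd t n = shiftPow (mulR t) n 1 := by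
  refine coef_ext fun q => ?_
  rw [zpowAdd, coef_shiftPow, coef_shiftPow]
  refine finsum_congr fun k => ?_
  congr 1
  rw [mulL_pow_apply, mulR_pow_apply, coef_one]
  split_ifs <;> simp

theorem zpowAdd_add_one' (t : E) (n : ℤ) :
    zpowAdd t (n + 1) = zpowAdd t n * (zvar + lconst t) := by
  rw [zpowAdd_eq, shiftPow_add_one, addVar_mulR, ← zpowAdd_eq]

theorem shiftPow_mulL (t : E) (n : ℤ) (f : Laurent E) :
    shiftPow (mulL t) n f = zpowAdd t n * f := by
  have := eq_shiftPow (mulL t) (f := fun n => zpowAdd t n * f)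
    (fun n => by rw [zpowAdd_add_one, addVar_mulL, mul_assoc]) n
  rw [this, zpowAdd_zero, one_mul]

theorem shiftPow_mulR (t : E) (n : ℤ) (f : Laurent E) :
    shiftPow (mulR t) n f = f * zpowAdd t n := by
  have := eq_shiftPow (mulR t) (f := fun n => f * zpowAdd t n)
    (fun n => by rw [zpowAdd_add_one', addVar_mulR, mul_assoc]) n
  rw [this, zpowAdd_zero, mul_one]

theorem zpowAdd_bound (t : E) (n q : ℤ) (hq : n < q) : coef (zpowAdd t n) q = 0 :=
  shiftPow_bound _ n (N := 0) (fun m hm => by rw [coef_one, if_neg (by omega)]) q (by omega)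

/-- Three separate maps are allowed so that the rule covers not only ring homomorphisms but also
maps linear over one of the factors, such as the substitutions below. -/
theorem lmap_mul_of_forall {E₁ E₂ : Type*} [Ring E₁] [Ring E₂] (F : E₁ →+ E₂)
    (G H : E₁ →+ E₂) (x y : Laurent E₁)
    (h : ∀ n m, F (coef x n * coef y m) = G (coef x n) * H (coef y m)) :
    lmap F (x * y) = lmap G x * lmap H y := by
  refine coef_ext fun q => ?_
  rw [coef_mul, coef_lmap, coef_mul]
  have : (Function.support fun n => coef x n * coef y (q - n)).Finite := by
    obtain ⟨N, hN⟩ := exists_coef_eq_zero x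
    obtain ⟨M, hM⟩ := exists_coef_eq_zero y
    refine (Set.finite_Icc (q - M) N).subset fun n hn => ?_
    by_contra h
    refine hn ?_
    by_cases hn : N < n
    · simp [hN n hn]
    · simp [hM (q - n) (by simp at h; by_contra; omega)]
  rw [AddMonoidHom.map_finsum _ this]
  exact finsum_congr fun n => by simp [h]

theorem lmap_mul {E' : Type*} [Ring E'] (i : E →+* E') (x y : Laurent E) :
    lmap (i : E →+ E') (x * y) = lmap (i : E →+ E') x * lmap (i : E →+ E') y :=
  lmap_mul_of_forall _ _ _ x y fun _ _ => map_mul i _ _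

theorem lmap_one {E' : Type*} [Ring E'] (i : E →+* E') : lmap (i : E →+ E') 1 = 1 :=
  coef_ext fun q => by
    rw [coef_lmap, coef_one, coef_one]
    split_ifs <;> simp

end Ring

/-! ### Symbol calculus in a ring containing `V` and `∂` -/

section Symbol

variable {V E : Type*} [CommRing V] [Ring E] (i : V →+* E) (t : E) (d : AddMonoid.End V)

/-- The symbol `a(z)` with coefficients in a ring `E` over `V`. -/
def symb : Laurent V →+ Laurent E := lmap (i : V →+ E)

@[simp] theorem coef_symb (a : Laurent V) (q : ℤ) : coef (symb i a) q = i (coef a q) := by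
  simp [symb]

theorem symb_mono (n : ℤ) (a : V) : symb i (mono n a) = mono n (i a) := lmap_mono _ _ _

theorem symb_mul (a b : Laurent V) : symb i (a * b) = symb i a * symb i b := lmap_mul i a b

theorem symb_lconst (a : V) : symb i (lconst a) = lconst (i a) := by
  rw [lconst_eq_mono, symb_mono, lconst_eq_mono]

theorem IsBounded.symb : IsBounded (symb i) := IsBounded.lmap _

theorem mono_eq_mul (n : ℤ) (e : E) : mono n e = lconst e * mono n 1 :=
  coef_ext fun q => by simp [coef_mono]

theorem lconst_mul_symb_comm (a : V) (b : Laurent V) :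
    lconst (i a) * symb i b = symb i b * lconst (i a) := by
  rw [← symb_lconst, ← symb_mul, mul_comm, symb_mul]

/-- `a(z + t) = ∑ₙ aₙ (z + t)ⁿ`. -/
def leftSymbol : Laurent V →+ Laurent E :=
  sumMap (fun n => (AddMonoidHom.mulRight (zpowAdd t n)).comp
    (((lconst : E →+* Laurent E).comp i : V →+* Laurent E) : V →+ Laurent E)) ⟨0, fun n e q hq => by
      simp [zpowAdd_bound t n q (by omega)]⟩

theorem leftSymbol_mono (n : ℤ) (a : V) :
    leftSymbol i t (mono n a) = lconst (i a) * zpowAdd t n := by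
  simp [leftSymbol, sumMap_mono]

theorem IsBounded.leftSymbol : IsBounded (leftSymbol i t) := IsBounded.sumMap _ _

/-- The symbol `∑ₙ (z - t)ⁿ aₙ`, that is, the symbol of the formal adjoint at `t - z`. -/
def dagger : Laurent V →+ Laurent E :=
  (reflect (mulR (-t))).comp ((symb i).comp (reflect d))

theorem dagger_apply (a : Laurent V) :
    dagger i t d a = reflect (mulR (-t)) (symb i (reflect d a)) := rfl

theorem IsBounded.dagger : IsBounded (dagger i t d) :=
  (IsBounded.reflect _).comp ((IsBounded.symb i).comp (.reflect d))

/-- The symbol `a(z + d) b(z)` of a product, for a fixed second factor. -/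
def opComp (b : Laurent V) : Laurent V →+ Laurent V :=
  sumMap (fun n => (AddMonoidHom.mulRight (shiftPow d n b)).comp (lconst : V →+* Laurent V)) (by
    obtain ⟨N, hN⟩ := exists_coef_eq_zero b
    exact ⟨N, fun n e q hq => by simp [shiftPow_bound d n hN q hq]⟩)

theorem opComp_mono (b : Laurent V) (n : ℤ) (a : V) :
    opComp d b (mono n a) = lconst a * shiftPow d n b := by
  simp [opComp, sumMap_mono]

theorem coef_opComp (b a : Laurent V) (q : ℤ) :
    coef (opComp d b a) q = ∑ᶠ n : ℤ, coef a n * coef (shiftPow d n b) q := by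
  simp [opComp, coef_sumMap]

theorem IsBounded.opComp (b : Laurent V) : IsBounded (opComp d b) := IsBounded.sumMap _ _

/-- Substitution `z ↦ z + y` in the variable of `f`, with `y` acting as `d` on the series `g`
placed on the left. -/
def substLeft (g : Laurent V) : Laurent E →+ Laurent E :=
  sumMap (fun n => (AddMonoidHom.mulLeft (symb i (shiftPow d n g))).comp
    (lconst : E →+* Laurent E)) (by
    obtain ⟨N, hN⟩ := exists_coef_eq_zero g
    exact ⟨N, fun n e q hq => by simp [shiftPow_bound d n hN q hq]⟩)

theorem substLeft_mono (g : Laurent V) (n : ℤ) (e : E) :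
    substLeft i d g (mono n e) = symb i (shiftPow d n g) * lconst e := by
  simp [substLeft, sumMap_mono]

theorem IsBounded.substLeft (g : Laurent V) : IsBounded (substLeft i d g) := IsBounded.sumMap _ _

/-- Substitution `z ↦ z + x` in the variable of `f`, with `x` acting as `d` on the series `g`
placed on the right. -/
def substRight (g : Laurent V) : Laurent E →+ Laurent E :=
  sumMap (fun n => (AddMonoidHom.mulRight (symb i (shiftPow d n g))).comp
    (lconst : E →+* Laurent E)) (by
    obtain ⟨N, hN⟩ := exists_coef_eq_zero g
    exact ⟨N, fun n e q hq => by simp [shiftPow_bound d n hN q hq]⟩)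

theorem substRight_mono (g : Laurent V) (n : ℤ) (e : E) :
    substRight i d g (mono n e) = lconst e * symb i (shiftPow d n g) := by
  simp [substRight, sumMap_mono]

theorem IsBounded.substRight (g : Laurent V) : IsBounded (substRight i d g) := IsBounded.sumMap _ _

theorem leftSymbol_lconst (a : V) : leftSymbol i t (lconst a) = lconst (i a) := by
  rw [lconst_eq_mono, leftSymbol_mono, zpowAdd_zero, mul_one]

variable {i t d} (h : ∀ a, t * i a = i a * t + i (d a))

include h in
theorem lconst_mul_symb (g : Laurent V) :
    lconst t * symb i g = symb i g * lconst t + symb i (lmap (endHom d) g) :=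
  coef_ext fun q => by simp [h]

include h in
theorem symb_addVar (g : Laurent V) :
    symb i (addVar d g) = (zvar + lconst t) * symb i g - symb i g * lconst t := by
  rw [addVar_apply, map_add, add_mul, lconst_mul_symb h, zvar_mul, symb, lmap_shift]
  abel

include h in
-- On a monomial this is the relation `t a = a t + d a`: moving `z + t` past the coefficient
-- produces its derivative.
theorem leftSymbol_addVar (a : Laurent V) :
    leftSymbol i t (addVar d a) = (zvar + lconst t) * leftSymbol i t a := by
  refine IsBounded.ext ((IsBounded.leftSymbol i t).comp (.addVar d))
    ((IsBounded.mulLeft _).comp (.leftSymbol i t)) (fun n e => ?_) a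
  rw [addVar_mono, map_add, leftSymbol_mono, leftSymbol_mono, leftSymbol_mono, zpowAdd_add_one,
    ← mul_assoc, ← add_mul, ← mul_assoc]
  congr 1
  rw [mul_add, add_mul, mul_zvar, add_assoc, ← map_mul, ← map_mul, ← map_add, h]

include h in
theorem leftSymbol_shiftPow (n : ℤ) (b : Laurent V) :
    leftSymbol i t (shiftPow d n b) = zpowAdd t n * leftSymbol i t b := by
  rw [← shiftPow_mulL]
  have := eq_shiftPow (mulL t) (f := fun n => leftSymbol i t (shiftPow d n b))
    (fun n => by rw [shiftPow_add_one, leftSymbol_addVar h, addVar_mulL]) n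
  simpa only [shiftPow_zero] using this

theorem leftSymbol_lconst_mul (a : V) (b : Laurent V) :
    leftSymbol i t (lconst a * b) = lconst (i a) * leftSymbol i t b := by
  refine IsBounded.ext ((IsBounded.leftSymbol i t).comp (.mulLeft _))
    ((IsBounded.mulLeft _).comp (.leftSymbol i t)) (fun n e => ?_) b
  rw [mono_eq_mul, ← mul_assoc, ← map_mul, ← mono_eq_mul, ← mono_eq_mul, leftSymbol_mono,
    leftSymbol_mono, map_mul, map_mul, mul_assoc]

include h in
-- Composition is governed by the commutation of `∂` with scalars, and `z + t` satisfies the same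
-- relation; so replacing `∂` by `z + t` respects products.
theorem leftSymbol_opComp (a b : Laurent V) :
    leftSymbol i t (opComp d b a) = leftSymbol i t a * leftSymbol i t b := by
  refine IsBounded.ext ((IsBounded.leftSymbol i t).comp (.opComp d b))
    ((IsBounded.mulRight _).comp (.leftSymbol i t)) (fun n e => ?_) a
  rw [opComp_mono, leftSymbol_lconst_mul, leftSymbol_shiftPow h, leftSymbol_mono, mul_assoc]

theorem reflect_mulR_lconst_mul (e : E) (f : Laurent E) :
    reflect (mulR t) (lconst e * f) = lconst e * reflect (mulR t) f := by
  rw [← lmap_mulL, ← lmap_mulL]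
  exact (lmap_reflect (fun x => by simp [mul_assoc]) f).symm

theorem reflect_mulL_mul_lconst (e : E) (f : Laurent E) :
    reflect (mulL t) (f * lconst e) = reflect (mulL t) f * lconst e := by
  rw [← lmap_mulR, ← lmap_mulR]
  exact (lmap_reflect (fun x => by simp [mul_assoc]) f).symm

include h in
theorem reflect_symb_addVar (g : Laurent V) :
    reflect (mulR (-t)) (symb i (addVar d g)) =
      -((zvar + lconst (-t)) * reflect (mulR (-t)) (symb i g)) := by
  have h1 : reflect (mulR (-t)) (symb i g * lconst t) =
      reflect (mulR (-t)) (symb i g) * lconst t := by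
    rw [← lmap_mulR, ← lmap_mulR]
    exact (lmap_reflect (fun x => by simp) _).symm
  rw [symb_addVar h, map_sub, add_mul, map_add, h1, zvar_mul, reflect_shift, addVar_mulR,
    reflect_mulR_lconst_mul, mul_add, mul_zvar, add_mul]
  simp only [map_neg]
  noncomm_ring

include h in
-- The definition writes `b*(t - z)` with coefficients on the left of powers of `t - z`. Moving them
-- to the right undoes the adjoint, leaving `(z - t)ⁿ b`.
theorem dagger_mono (n : ℤ) (b : V) :
    dagger i t d (mono n b) = zpowAdd (-t) n * lconst (i b) := by
  rw [← shiftPow_mulL]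
  have := eq_shiftPow (mulL (-t)) (f := fun n => dagger i t d (mono n b)) (fun n => by
    simp only [dagger_apply, reflect_mono, shiftPow_add_one, negOnePow_add_one_smul, map_neg,
      map_zsmul, reflect_symb_addVar h, addVar_mulL]
    rw [smul_neg, neg_neg]) n
  rw [this, dagger_apply, reflect_mono_zero, symb_mono, reflect_mono_zero, lconst_eq_mono]

include h in
theorem dagger_lconst (a : V) : dagger i t d (lconst a) = lconst (i a) := by
  rw [lconst_eq_mono, dagger_mono h, zpowAdd_zero, one_mul]

include h in
theorem leftSymbol_reflect (b : Laurent V) :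
    leftSymbol i t (reflect d b) = reflect (mulL t) (symb i b) := by
  refine IsBounded.ext ((IsBounded.leftSymbol i t).comp (.reflect d))
    ((IsBounded.reflect _).comp (.symb i)) (fun n e => ?_) b
  rw [reflect_mono, map_zsmul, leftSymbol_shiftPow h, symb_mono, reflect_mono, shiftPow_mulL,
    ← lconst_eq_mono, leftSymbol_lconst, lconst_eq_mono]

theorem dagger_reflect (b : Laurent V) :
    dagger i t d (reflect d b) = reflect (mulR (-t)) (symb i b) := by
  rw [dagger_apply, reflect_reflect]

include h in
theorem dagger_addVar (b : Laurent V) :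
    dagger i t d (addVar d b) = dagger i t d b * (zvar + lconst (-t)) := by
  refine IsBounded.ext ((IsBounded.dagger i t d).comp (.addVar d))
    ((IsBounded.mulRight _).comp (.dagger i t d)) (fun n e => ?_) b
  rw [addVar_mono, map_add, dagger_mono h, dagger_mono h, dagger_mono h, zpowAdd_add_one', mul_assoc,
    mul_assoc, ← mul_add]
  congr 1
  rw [mul_add, add_mul, mul_zvar, add_assoc, ← map_mul, ← map_mul, ← map_add, neg_mul, h]
  congr 2
  simp

include h in
theorem dagger_shiftPow (n : ℤ) (b : Laurent V) :
    dagger i t d (shiftPow d n b) = dagger i t d b * zpowAdd (-t) n := by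
  rw [← shiftPow_mulR]
  have := eq_shiftPow (mulR (-t)) (f := fun n => dagger i t d (shiftPow d n b))
    (fun n => by rw [shiftPow_add_one, dagger_addVar h, addVar_mulR]) n
  simpa only [shiftPow_zero] using this

include h in
theorem dagger_lconst_mul (a : V) (b : Laurent V) :
    dagger i t d (lconst a * b) = dagger i t d b * lconst (i a) := by
  refine IsBounded.ext ((IsBounded.dagger i t d).comp (.mulLeft _))
    ((IsBounded.mulRight _).comp (.dagger i t d)) (fun n e => ?_) b
  rw [mono_eq_mul, ← mul_assoc, ← map_mul, ← mono_eq_mul, ← mono_eq_mul, dagger_mono h,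
    dagger_mono h, mul_comm a, map_mul, map_mul, mul_assoc]

include h in
-- Coefficients stand on the right of powers of `z - t`, so the relation between `t` and scalars now
-- reverses the order of factors, as `(A∘B)* = B*∘A*` does.
theorem dagger_opComp (a b : Laurent V) :
    dagger i t d (opComp d b a) = dagger i t d b * dagger i t d a := by
  refine IsBounded.ext ((IsBounded.dagger i t d).comp (.opComp d b))
    ((IsBounded.mulLeft _).comp (.dagger i t d)) (fun n e => ?_) a
  rw [opComp_mono, dagger_lconst_mul h, dagger_shiftPow h, dagger_mono h, mul_assoc]

/-! #### Properties of the substitutions -/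

theorem substLeft_mul_lconst (g : Laurent V) (f : Laurent E) (e : E) :
    substLeft i d g (f * lconst e) = substLeft i d g f * lconst e := by
  refine IsBounded.ext ((IsBounded.substLeft i d g).comp (.mulRight _))
    ((IsBounded.mulRight _).comp (.substLeft i d g)) (fun n x => ?_) f
  rw [← lmap_mulR, lmap_mono, substLeft_mono, substLeft_mono, mul_assoc, ← map_mul]
  rfl

theorem substLeft_lconst_mul (g : Laurent V) (a : V) (f : Laurent E) :
    substLeft i d g (lconst (i a) * f) = lconst (i a) * substLeft i d g f := by
  refine IsBounded.ext ((IsBounded.substLeft i d g).comp (.mulLeft _))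
    ((IsBounded.mulLeft _).comp (.substLeft i d g)) (fun n x => ?_) f
  rw [← lmap_mulL, lmap_mono, substLeft_mono, substLeft_mono, ← mul_assoc, lconst_mul_symb_comm,
    mul_assoc, ← map_mul]
  rfl

include h in
-- Moving `t` past `g` differentiates `g`, which is precisely the shift `z ↦ z + y` made by the
-- substitution; the two effects cancel.
theorem substLeft_addVar (g : Laurent V) (f : Laurent E) :
    substLeft i d g ((zvar + lconst t) * f) = (zvar + lconst t) * substLeft i d g f := by
  refine IsBounded.ext ((IsBounded.substLeft i d g).comp (.mulLeft _))
    ((IsBounded.mulLeft _).comp (.substLeft i d g)) (fun n x => ?_) f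
  rw [← addVar_mulL, addVar_mono, map_add, substLeft_mono, substLeft_mono, substLeft_mono,
    shiftPow_add_one, symb_addVar h, mulL_apply, map_mul]
  noncomm_ring

include h in
theorem substLeft_zpowAdd (g : Laurent V) (n : ℤ) (f : Laurent E) :
    substLeft i d g (zpowAdd t n * f) = zpowAdd t n * substLeft i d g f := by
  rw [← shiftPow_mulL, ← shiftPow_mulL]
  have := eq_shiftPow (mulL t) (f := fun n => substLeft i d g (shiftPow (mulL t) n f))
    (fun n => by rw [shiftPow_add_one, addVar_mulL, addVar_mulL, substLeft_addVar h]) n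
  simpa only [shiftPow_zero] using this

include h in
theorem substLeft_leftSymbol (g a : Laurent V) (f : Laurent E) :
    substLeft i d g (leftSymbol i t a * f) = leftSymbol i t a * substLeft i d g f := by
  refine IsBounded.ext
    ((IsBounded.substLeft i d g).comp ((IsBounded.mulRight _).comp (.leftSymbol i t)))
    ((IsBounded.mulRight _).comp (.leftSymbol i t)) (fun n x => ?_) a
  rw [leftSymbol_mono, mul_assoc, substLeft_lconst_mul, substLeft_zpowAdd h, mul_assoc]

theorem substLeft_one (g : Laurent V) : substLeft i d g 1 = symb i g := by
  rw [← map_one lconst, lconst_eq_mono, substLeft_mono, shiftPow_zero, map_one, mul_one]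

theorem substLeft_symb (g a : Laurent V) : substLeft i d g (symb i a) = symb i (opComp d g a) := by
  refine IsBounded.ext ((IsBounded.substLeft i d g).comp (.symb i))
    ((IsBounded.symb i).comp (.opComp d g)) (fun n x => ?_) a
  rw [symb_mono, substLeft_mono, opComp_mono, symb_mul, symb_lconst, lconst_mul_symb_comm]

theorem substRight_lconst_mul (g : Laurent V) (e : E) (f : Laurent E) :
    substRight i d g (lconst e * f) = lconst e * substRight i d g f := by
  refine IsBounded.ext ((IsBounded.substRight i d g).comp (.mulLeft _))
    ((IsBounded.mulLeft _).comp (.substRight i d g)) (fun n x => ?_) f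
  rw [← lmap_mulL, lmap_mono, substRight_mono, substRight_mono, ← mul_assoc, ← map_mul]
  rfl

theorem substRight_mul_lconst (g : Laurent V) (f : Laurent E) (e : E)
    (he : ∀ a, i a * e = e * i a) :
    substRight i d g (f * lconst e) = substRight i d g f * lconst e := by
  refine IsBounded.ext ((IsBounded.substRight i d g).comp (.mulRight _))
    ((IsBounded.mulRight _).comp (.substRight i d g)) (fun n x => ?_) f
  rw [← lmap_mulR, lmap_mono, substRight_mono, substRight_mono, mul_assoc]
  have : symb i (shiftPow d n g) * lconst e = lconst e * symb i (shiftPow d n g) :=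
    coef_ext fun q => by simp [he]
  rw [this, ← mul_assoc, ← map_mul]
  rfl

include h in
-- Mirror image of `substLeft_addVar`: the factor now passes `g` from the right, hence `z - t` in
-- place of `z + t`.
theorem substRight_addVar (g : Laurent V) (f : Laurent E) :
    substRight i d g (f * (zvar + lconst (-t))) = substRight i d g f * (zvar + lconst (-t)) := by
  refine IsBounded.ext ((IsBounded.substRight i d g).comp (.mulRight _))
    ((IsBounded.mulRight _).comp (.substRight i d g)) (fun n x => ?_) f
  rw [← addVar_mulR, addVar_mono, map_add, substRight_mono, substRight_mono, substRight_mono,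
    shiftPow_add_one, symb_addVar h, mulR_apply, map_mul, map_neg, mul_add, mul_zvar, mul_sub,
    add_mul zvar, mul_add, ← mul_assoc (lconst x) zvar, mul_zvar]
  noncomm_ring

include h in
theorem substRight_zpowAdd (g : Laurent V) (n : ℤ) (f : Laurent E) :
    substRight i d g (f * zpowAdd (-t) n) = substRight i d g f * zpowAdd (-t) n := by
  rw [← shiftPow_mulR, ← shiftPow_mulR]
  have := eq_shiftPow (mulR (-t)) (f := fun n => substRight i d g (shiftPow (mulR (-t)) n f))
    (fun n => by rw [shiftPow_add_one, addVar_mulR, addVar_mulR, substRight_addVar h]) n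
  simpa only [shiftPow_zero] using this

include h in
theorem substRight_dagger (g a : Laurent V) (f : Laurent E) :
    substRight i d g (f * dagger i t d a) = substRight i d g f * dagger i t d a := by
  refine IsBounded.ext
    ((IsBounded.substRight i d g).comp ((IsBounded.mulLeft _).comp (.dagger i t d)))
    ((IsBounded.mulLeft _).comp (.dagger i t d)) (fun n x => ?_) a
  rw [dagger_mono h, ← mul_assoc, substRight_mul_lconst _ _ _ fun a => ?_, substRight_zpowAdd h,
    mul_assoc]
  rw [← map_mul, mul_comm, map_mul]

theorem substRight_one (g : Laurent V) : substRight i d g 1 = symb i g := by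
  rw [← map_one lconst, lconst_eq_mono, substRight_mono, shiftPow_zero, map_one, one_mul]

theorem substRight_symb (g a : Laurent V) :
    substRight i d g (symb i a) = symb i (opComp d g a) := by
  refine IsBounded.ext ((IsBounded.substRight i d g).comp (.symb i))
    ((IsBounded.symb i).comp (.opComp d g)) (fun n x => ?_) a
  rw [symb_mono, substRight_mono, opComp_mono, symb_mul, symb_lconst]

end Symbol

section Bracket

variable {V E : Type*} [CommRing V] [Ring E] {i : V →+* E} {t : E} {d : AddMonoid.End V}

/-! ### Derivations into `E` -/

/-- For `a = x zⁿ` the product is `x (z + d)ⁿ b`. If `δ` hits `b`, each `d` becomes a left factor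
`t`, giving `a(z + t)`; if it hits `x`, the remaining `(z + d)ⁿ b` is a substitution. -/
theorem lmap_opComp_left (δ : V →+ E)
    (hd : ∀ a, δ (d a) = t * δ a) (hm : ∀ a b, δ (a * b) = i b * δ a + i a * δ b)
    (a b : Laurent V) :
    lmap δ (opComp d b a) = leftSymbol i t a * lmap δ b + substLeft i d b (lmap δ a) := by
  refine IsBounded.ext ((IsBounded.lmap δ).comp (.opComp d b))
    (((IsBounded.mulRight _).comp (.leftSymbol i t)).add
      ((IsBounded.substLeft i d b).comp (.lmap δ))) (fun n x => ?_) a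
  have hmul : ∀ f, lmap δ (lconst x * f) = symb i f * lconst (δ x) + lconst (i x) * lmap δ f :=
    fun f => coef_ext fun q => by simp [hm]
  rw [opComp_mono, hmul, lmap_shiftPow (T := d) (T' := mulL t) hd, shiftPow_mulL, leftSymbol_mono,
    lmap_mono, substLeft_mono, mul_assoc, add_comm]

/-- As in the left version, but `d` becomes a right factor `-t`, so powers of `z - t` collect on the
right and form the symbol of the adjoint. -/
theorem lmap_opComp_right (h : ∀ a, t * i a = i a * t + i (d a)) (η : V →+ E)
    (hd : ∀ a, η (d a) = -(η a * t)) (hm : ∀ a b, η (a * b) = η a * i b + η b * i a)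
    (a b : Laurent V) :
    lmap η (opComp d b a) = lmap η b * dagger i t d a + substRight i d b (lmap η a) := by
  refine IsBounded.ext ((IsBounded.lmap η).comp (.opComp d b))
    (((IsBounded.mulLeft _).comp (.dagger i t d)).add
      ((IsBounded.substRight i d b).comp (.lmap η))) (fun n x => ?_) a
  have hmul : ∀ f, lmap η (lconst x * f) = lconst (η x) * symb i f + lmap η f * lconst (i x) :=
    fun f => coef_ext fun q => by simp [hm]
  rw [opComp_mono, hmul, lmap_shiftPow (T := d) (T' := mulR (-t)) (fun x => by simp [hd]),
    shiftPow_mulR, dagger_mono h, lmap_mono, substRight_mono, mul_assoc, add_comm]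

variable (i t d) in
/-- A bracket with values in a ring `E` containing `V` and an element `t` acting as `∂`. -/
structure RingBracket where
  /-- the bracket -/
  br : V →+ V →+ E
  der_left : ∀ a b, br (d a) b = -(br a b * t)
  der_right : ∀ a b, br a (d b) = t * br a b
  mul_right : ∀ a b c, br a (b * c) = i c * br a b + i b * br a c
  mul_left : ∀ a b c, br (a * b) c = br a c * i b + br b c * i a

namespace RingBracket

variable (B : RingBracket i t d)

/-- The bracket of an element with a series in `w`. -/
def slice (b : Laurent V) : V →+ Laurent E where
  toFun x := lmap (B.br x) b
  map_zero' := coef_ext fun q => by simp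
  map_add' x y := coef_ext fun q => by simp

@[simp] theorem coef_slice (b : Laurent V) (x : V) (q : ℤ) :
    coef (B.slice b x) q = B.br x (coef b q) := by
  simp [slice]

/-- The series `∑ {aₚ, b_q} z^p w^q`. -/
def ser : Laurent V →+ Laurent V →+ Laurent (Laurent E) :=
  AddMonoidHom.mk' (fun a => AddMonoidHom.mk' (fun b => lmap (B.slice b) a) fun b b' =>
    coef_ext fun p => coef_ext fun q => by simp) fun a a' =>
      AddMonoidHom.ext fun b => coef_ext fun p => coef_ext fun q => by simp

theorem ser_apply (a b : Laurent V) : B.ser a b = lmap (B.slice b) a := rfl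

@[simp] theorem coef_ser (a b : Laurent V) (p q : ℤ) :
    coef (coef (B.ser a b) p) q = B.br (coef a p) (coef b q) := by
  simp [ser_apply]

theorem br_one_right (a : V) : B.br a 1 = 0 := by
  simpa using B.mul_right a 1 1

theorem br_one_left (a : V) : B.br 1 a = 0 := by
  simpa using B.mul_left 1 1 a

theorem ser_one_right (a : Laurent V) : B.ser a 1 = 0 :=
  coef_ext fun p => coef_ext fun q => by
    rw [coef_ser, coef_one]
    split_ifs <;> simp [br_one_right]

theorem ser_one_left (a : Laurent V) : B.ser 1 a = 0 :=
  coef_ext fun p => coef_ext fun q => by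
    rw [coef_ser, coef_one]
    split_ifs <;> simp [br_one_left]

end RingBracket

/-! ### Series in two variables -/

theorem lconst_mul_comm_rel (h : ∀ a, t * i a = i a * t + i (d a)) (a : V) :
    lconst t * (lconst.comp i) a = (lconst.comp i) a * lconst t + (lconst.comp i) (d a) := by
  simp only [RingHom.comp_apply, ← map_mul, ← map_add, h]

variable (i) in
/-- The symbol `a(z)` among the series in `z` and `w`. -/
abbrev symbZ : Laurent V →+ Laurent (Laurent E) := symb (lconst.comp i)

variable (i t d) in
/-- The symbol `∑ₙ (z - t)ⁿ aₙ` among the series in `z` and `w`. -/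
abbrev daggerZ : Laurent V →+ Laurent (Laurent E) := dagger (lconst.comp i) (lconst t) d

variable (t) in
/-- The series `(z - w - t)⁻¹`, expanded for large `z`. -/
def invSub : Laurent (Laurent E) := zpowAdd (-(zvar + lconst t)) (-1)

theorem mul_invSub : (zvar + lconst (-(zvar + lconst t))) * invSub t = 1 := by
  rw [invSub, ← zpowAdd_add_one, neg_add_cancel, zpowAdd_zero]

theorem invSub_mul : invSub t * (zvar + lconst (-(zvar + lconst t))) = 1 := by
  rw [invSub, ← zpowAdd_add_one', neg_add_cancel, zpowAdd_zero]

variable (i t d) in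
/-- The series `a(w + t) (z - w - t)⁻¹ b*(t - z) - a(z) (z - w - t)⁻¹ b(w)`. -/
def adlerSer (a b : Laurent V) : Laurent (Laurent E) :=
  lconst (leftSymbol i t a) * invSub t * daggerZ i t d b -
    symbZ i a * invSub t * lconst (symb i b)

theorem daggerZ_eq (a : Laurent V) :
    daggerZ i t d a = lmap ((lconst : E →+* Laurent E) : E →+ Laurent E) (dagger i t d a) := by
  rw [dagger_apply, dagger_apply, lmap_reflect (T := mulR (-t)) (T' := mulR (-lconst t))
    (fun x => by simp)]
  congr 1
  exact coef_ext fun q => by simp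

theorem lconst_zvar_comm (f : Laurent (Laurent E)) : lconst zvar * f = f * lconst zvar :=
  coef_ext fun q => by rw [coef_lconst_mul, coef_mul_lconst, mul_zvar]

theorem lmap_lconst_apply {E₁ E₂ : Type*} [Ring E₁] [Ring E₂] (F : E₁ →+ E₂) (e : E₁) :
    lmap F (lconst e) = lconst (F e) := by
  rw [lconst_eq_mono, lmap_mono, lconst_eq_mono]

/-! ### Substitutions in the two variables -/

section Subst

variable (h : ∀ a, t * i a = i a * t + i (d a))

include h in
-- The substitution commutes with right multiplication by `z - w - t`, hence with that by its
-- two-sided inverse.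
theorem substRight_invSub (g : Laurent V) (f : Laurent (Laurent E)) :
    substRight (lconst.comp i) d g (f * invSub t) =
      substRight (lconst.comp i) d g f * invSub t := by
  have key : ∀ f : Laurent (Laurent E), substRight (lconst.comp i) d g
      (f * (zvar + lconst (-(zvar + lconst t)))) =
      substRight (lconst.comp i) d g f * (zvar + lconst (-(zvar + lconst t))) := by
    intro f
    -- `w` is central and is not affected by the substitution in `z`, so only `z - t` needs the
    -- earlier lemma.
    have e : (zvar + lconst (-(zvar + lconst t)) : Laurent (Laurent E)) =
        (zvar + lconst (-lconst t)) - lconst zvar := by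
      simp only [map_neg, map_add]; abel
    rw [e, mul_sub, map_sub, substRight_addVar (lconst_mul_comm_rel h),
      substRight_mul_lconst _ _ _ fun a => mul_zvar _, ← mul_sub]
  calc substRight (lconst.comp i) d g (f * invSub t)
      = substRight (lconst.comp i) d g (f * invSub t) *
          (zvar + lconst (-(zvar + lconst t))) * invSub t := by
        rw [mul_assoc, mul_invSub, mul_one]
    _ = _ := by rw [← key, mul_assoc, invSub_mul, mul_one]

include h in
theorem substLeft_lmap_lconst_leftSymbol (g a : Laurent V) (f : Laurent (Laurent E)) :
    lmap (substLeft i d g) (lconst (leftSymbol i t a) * f) =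
      lconst (leftSymbol i t a) * lmap (substLeft i d g) f :=
  coef_ext fun q => by
    rw [coef_lmap, coef_lconst_mul, coef_lconst_mul, coef_lmap, substLeft_leftSymbol h]

theorem substLeft_lmap_symbZ (g a : Laurent V) (f : Laurent (Laurent E)) :
    lmap (substLeft i d g) (symbZ i a * f) = symbZ i a * lmap (substLeft i d g) f := by
  have e : ∀ x : Laurent (Laurent E), lmap (AddMonoidHom.id _) x = x := fun x =>
    coef_ext fun q => by simp
  rw [lmap_mul_of_forall _ (AddMonoidHom.id _) (substLeft i d g), e]
  intro n m
  simp [substLeft_lconst_mul]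

include h in
theorem substLeft_lmap_invSub (g : Laurent V) (f : Laurent (Laurent E)) :
    lmap (substLeft i d g) (invSub t * f) = invSub t * lmap (substLeft i d g) f := by
  rw [invSub, ← shiftPow_mulL, ← shiftPow_mulL]
  refine lmap_shiftPow (fun x => ?_) _ _
  rw [mulL_apply, mulL_apply, neg_mul, map_neg, substLeft_addVar h, neg_mul]

theorem substLeft_lmap_mul_daggerZ (g a : Laurent V) (f : Laurent (Laurent E)) :
    lmap (substLeft i d g) (f * daggerZ i t d a) =
      lmap (substLeft i d g) f * daggerZ i t d a := by
  have e : ∀ x : Laurent (Laurent E), lmap (AddMonoidHom.id _) x = x := fun x =>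
    coef_ext fun q => by simp
  rw [lmap_mul_of_forall _ (substLeft i d g) (AddMonoidHom.id _), e]
  intro n m
  rw [daggerZ_eq, coef_lmap]
  exact substLeft_mul_lconst _ _ _

include h in
theorem substRight_adlerSer (b a a' : Laurent V) :
    substRight (lconst.comp i) d b (adlerSer i t d a a') =
      lconst (leftSymbol i t a) * (symbZ i b * (invSub t * daggerZ i t d a')) -
        symbZ i (opComp d b a) * (invSub t * lconst (symb i a')) := by
  have h1 : substRight (lconst.comp i) d b (invSub t) = symbZ i b * invSub t := by
    rw [← one_mul (invSub t), substRight_invSub h, substRight_one, one_mul]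
  rw [adlerSer, map_sub, substRight_dagger (lconst_mul_comm_rel h), substRight_lconst_mul, h1,
    substRight_mul_lconst _ _ _ fun a => ?_, substRight_invSub h, substRight_symb]
  · simp only [mul_assoc]
  · rw [RingHom.comp_apply, lconst_mul_symb_comm]

include h in
-- In the second term the substitutions complete `a` and `a'` to the compositions with `b` and `c`.
-- In the first they cannot enter the outer symbols, so `b(z)` and `c(w)` remain around `(z-w-t)⁻¹`;
-- this is the term that must cancel for products.
theorem substLeft_substRight_adlerSer (b c a a' : Laurent V) :
    lmap (substLeft i d c) (substRight (lconst.comp i) d b (adlerSer i t d a a')) =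
      lconst (leftSymbol i t a) * symbZ i b * invSub t * (lconst (symb i c) * daggerZ i t d a') -
        symbZ i (opComp d b a) * invSub t * lconst (symb i (opComp d c a')) := by
  have h1 : lmap (substLeft i d c) (daggerZ i t d a') = lconst (symb i c) * daggerZ i t d a' := by
    rw [← one_mul (daggerZ i t d a'), substLeft_lmap_mul_daggerZ, ← map_one lconst,
      lmap_lconst_apply, substLeft_one, map_one, one_mul]
  rw [substRight_adlerSer h, map_sub, substLeft_lmap_lconst_leftSymbol h, substLeft_lmap_symbZ,
    substLeft_lmap_invSub h, h1, substLeft_lmap_symbZ, substLeft_lmap_invSub h, lmap_lconst_apply,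
    substLeft_symb]
  simp only [mul_assoc]

end Subst

end Bracket

/-! ### The Adler identity over `E` -/

section Adler

variable {V E : Type*} [CommRing V] [Ring E] {i : V →+* E} {t : E} {d : AddMonoid.End V}

namespace RingBracket

variable (B : RingBracket i t d)

theorem ser_opComp_right (a b c : Laurent V) :
    B.ser a (opComp d c b) =
      lconst (leftSymbol i t b) * B.ser a c + lmap (substLeft i d c) (B.ser a b) := by
  refine coef_ext fun p => ?_
  have hs : ∀ b, coef (B.ser a b) p = lmap (B.br (coef a p)) b := fun b => coef_ext fun q => by simp
  rw [coef_add, coef_lconst_mul, coef_lmap, hs, hs, hs]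
  exact lmap_opComp_left _ (B.der_right _) (B.mul_right _) _ _

theorem ser_opComp_left (h : ∀ a, t * i a = i a * t + i (d a)) (a b c : Laurent V) :
    B.ser (opComp d b a) c =
      B.ser b c * daggerZ i t d a + substRight (lconst.comp i) d b (B.ser a c) := by
  refine lmap_opComp_right (lconst_mul_comm_rel h) (B.slice c) (fun a => ?_) (fun a b => ?_) _ _
  · exact coef_ext fun q => by simp [B.der_left]
  · exact coef_ext fun q => by simp [B.mul_left]

/-- A derivative in the second slot is left multiplication by `t`, in the first slot right
multiplication by `-t`; the adjoint therefore turns into a reflection in each variable. -/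
theorem ser_reflect (a b : Laurent V) :
    B.ser (reflect d a) (reflect d b) =
      lmap (reflect (mulL t)) (reflect (mulR (-lconst t)) (B.ser a b)) := by
  have h1 : ∀ a, B.ser a (reflect d b) = lmap (reflect (mulL t)) (B.ser a b) := by
    refine fun a => coef_ext fun p => ?_
    have hs : ∀ b, coef (B.ser a b) p = lmap (B.br (coef a p)) b :=
      fun b => coef_ext fun q => by simp
    rw [coef_lmap, hs, hs]
    exact lmap_reflect (T := d) (T' := mulL t) (B.der_right _) b
  rw [h1, ser_apply]
  congr 1
  exact lmap_reflect (fun x => coef_ext fun q => by simp [B.der_left]) a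

/-- The Adler identity for a matrix of series. -/
def IsAdlerSer {m n : Type*} (A : m → n → Laurent V) : Prop :=
  ∀ p q r s, B.ser (A p q) (A r s) = adlerSer i t d (A r q) (A p s)

end RingBracket

/-! ### The formal adjoint -/

section Reflect

/-- Multiplying by `z + s` raises the degree by one, while differentiating coefficients of `a` does
not raise the bound on `a`. The degree bound on `F a` thus improves by one each time the relation is
used, uniformly in `a`, so `F a = 0`. -/
theorem eq_zero_of_mul_sub {K : Type*} [Ring K] (s : K)
    {F : Laurent V → Laurent K} (hF : IsBounded F)
    (hs : ∀ a, F a * (zvar + lconst s) = F (lmap (endHom d) a)) (a : Laurent V) : F a = 0 := by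
  obtain ⟨c, hc⟩ := hF.bound
  obtain ⟨N, hN⟩ := exists_coef_eq_zero a
  have key : ∀ k : ℕ, ∀ a : Laurent V, (∀ n, N < n → coef a n = 0) →
      ∀ n, N + c - k < n → coef (F a) n = 0 := by
    intro k
    induction k with
    | zero => intro a ha n hn; exact hc a N ha n (by simpa using hn)
    | succ k ih =>
      intro a ha n hn
      push_cast at hn
      have h1 := congrArg (coef · (n + 1)) (hs a)
      simp only [← addVar_mulR, coef_addVar] at h1
      rwa [ih a ha (n + 1) (by omega), map_zero, add_zero, add_sub_cancel_right,
        ih _ (fun m hm => by simp [ha m hm]) (n + 1) (by omega)] at h1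
  exact coef_ext fun n => key (N + c - n + 1).toNat a hN n (by omega)

variable (h : ∀ a, t * i a = i a * t + i (d a))

theorem zvar_add_lconst_neg :
    (zvar + lconst (-(zvar + lconst t)) : Laurent (Laurent E)) =
      zvar - lconst zvar - lconst (lconst t) := by
  rw [map_neg, map_add]; abel

variable (t) in
/-- The substitution `z ↦ t - z`, `w ↦ - w - t`. -/
def reflect₂ (f : Laurent (Laurent E)) : Laurent (Laurent E) :=
  lmap (reflect (mulL t)) (reflect (mulR (-lconst t)) f)

theorem IsBounded.reflect₂ : IsBounded (reflect₂ t) := (IsBounded.lmap _).comp (.reflect _)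

theorem reflect₂_neg (f : Laurent (Laurent E)) : reflect₂ t (-f) = -reflect₂ t f := by
  simp [reflect₂]

theorem reflect₂_sub (f g : Laurent (Laurent E)) :
    reflect₂ t (f - g) = reflect₂ t f - reflect₂ t g := by
  simp [reflect₂]

theorem lmap_reflect_comm (f : Laurent (Laurent E)) :
    lmap (reflect (mulL t)) (reflect (mulR (-lconst t)) f) =
      reflect (mulR (-lconst t)) (lmap (reflect (mulL t)) f) :=
  lmap_reflect (fun x => by
    simp only [mulR_apply, ← map_neg, reflect_mulL_mul_lconst]) f

theorem reflect₂_reflect₂ (f : Laurent (Laurent E)) : reflect₂ t (reflect₂ t f) = f := by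
  rw [reflect₂, reflect₂, ← lmap_reflect_comm, reflect_reflect, lmap_lmap]
  exact coef_ext fun q => by simp [reflect_reflect]

/-- Left multiplication by `z` turns into right multiplication by `t - z`, and that by `w + t` into
multiplication by the central `-w`. So `z - w - t` changes sign and side. -/
theorem reflect₂_mul_sub (f : Laurent (Laurent E)) :
    reflect₂ t ((zvar + lconst (-(zvar + lconst t))) * f) =
      -(reflect₂ t f * (zvar + lconst (-(zvar + lconst t)))) := by
  have h1 : lmap (reflect (mulL t)) (lconst (-(zvar + lconst t)) * reflect (mulR (-lconst t)) f) =
      lconst zvar * reflect₂ t f := by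
    refine coef_ext fun q => ?_
    rw [coef_lmap, coef_lconst_mul, neg_mul, map_neg, ← addVar_mulL, reflect_addVar, neg_neg,
      coef_lconst_mul, reflect₂, coef_lmap, zvar_mul]
  have h2 : lmap (reflect (mulL t)) (addVar (mulR (-lconst t)) (reflect (mulR (-lconst t)) f)) =
      reflect₂ t f * (zvar - lconst (lconst t)) := by
    rw [lmap_addVar (T' := mulR (-lconst t)), addVar_mulR, reflect₂, map_neg lconst,
      ← sub_eq_add_neg]
    intro x
    simp only [mulR_apply, ← map_neg, reflect_mulL_mul_lconst]
  rw [reflect₂, add_mul, map_add, zvar_mul, reflect_shift, map_add, map_neg, h2,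
    reflect_mulR_lconst_mul, h1, lconst_zvar_comm, zvar_add_lconst_neg]
  simp only [mul_sub]
  abel

include h in
theorem sub_mul_symbZ (a : Laurent V) :
    (zvar + lconst (-(zvar + lconst t))) * symbZ i a =
      symbZ i a * (zvar + lconst (-(zvar + lconst t))) - symbZ i (lmap (endHom d) a) := by
  have h1 := lconst_mul_symb (lconst_mul_comm_rel h) a
  have h2 := lconst_zvar_comm (symbZ i a)
  simp only [zvar_add_lconst_neg, sub_mul, mul_sub, h1, h2, mul_zvar]
  abel

include h in
theorem daggerZ_reflect_mul_sub (a : Laurent V) :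
    daggerZ i t d (reflect d a) * (zvar + lconst (-(zvar + lconst t))) =
      (zvar + lconst (-(zvar + lconst t))) * daggerZ i t d (reflect d a) +
        daggerZ i t d (reflect d (lmap (endHom d) a)) := by
  have h1 : lconst (lconst t) * daggerZ i t d (reflect d a) =
      daggerZ i t d (reflect d a) * lconst (lconst t) +
        daggerZ i t d (reflect d (lmap (endHom d) a)) := by
    have h3 := congrArg (reflect (mulR (-lconst t))) (lconst_mul_symb (lconst_mul_comm_rel h) a)
    rw [map_add, reflect_mulR_lconst_mul, ← lmap_mulR,
      ← lmap_reflect (T := mulR (-lconst t)) (fun x => by simp), lmap_mulR] at h3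
    simpa only [daggerZ, dagger_reflect] using h3
  have h2 := lconst_zvar_comm (daggerZ i t d (reflect d a))
  simp only [zvar_add_lconst_neg, sub_mul, mul_sub, h1, h2, mul_zvar]
  abel

theorem symbZ_mul_lconst_symb_comm (a b : Laurent V) :
    symbZ i a * lconst (symb i b) = lconst (symb i b) * symbZ i a :=
  coef_ext fun q => by
    rw [coef_lconst_mul, coef_mul_lconst, coef_symb, RingHom.comp_apply, lconst_mul_symb_comm]

include h in
theorem reflect₂_symbZ_mul (a b : Laurent V) :
    reflect₂ t (symbZ i a * lconst (symb i b)) =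
      lconst (leftSymbol i t (reflect d b)) * daggerZ i t d (reflect d a) := by
  rw [symbZ_mul_lconst_symb_comm, reflect₂, reflect_mulR_lconst_mul, leftSymbol_reflect h,
    ← dagger_reflect, daggerZ_eq]
  refine coef_ext fun q => ?_
  rw [coef_lmap, coef_lconst_mul, coef_lconst_mul, coef_lmap]
  exact reflect_mulL_mul_lconst _ _

include h in
-- Reflection does not obviously respect `(z-w-t)⁻¹`. Instead, the sum `F a` of the left side and
-- the negated right side satisfies `F a · (z-w-t) = F (∂a)`, the terms free of the inverse
-- cancelling; this forces `F = 0`.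
theorem reflect₂_symbZ_mul_invSub (a b : Laurent V) :
    reflect₂ t (symbZ i a * invSub t * lconst (symb i b)) =
      -(lconst (leftSymbol i t (reflect d b)) * invSub t * daggerZ i t d (reflect d a)) := by
  rw [← add_eq_zero_iff_eq_neg]
  refine eq_zero_of_mul_sub (d := d) (-(zvar + lconst t))
    (F := fun a => reflect₂ t (symbZ i a * invSub t * lconst (symb i b)) +
      lconst (leftSymbol i t (reflect d b)) * invSub t * daggerZ i t d (reflect d a))
    ((IsBounded.reflect₂.comp ((IsBounded.mulRight _).comp
      ((IsBounded.mulRight _).comp (.symb _)))).add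
      ((IsBounded.mulLeft _).comp ((IsBounded.dagger _ _ _).comp (.reflect _)))) (fun a => ?_) a
  have h1 : reflect₂ t (symbZ i a * invSub t * lconst (symb i b)) *
      (zvar + lconst (-(zvar + lconst t))) =
      reflect₂ t (symbZ i (lmap (endHom d) a) * invSub t * lconst (symb i b)) -
        lconst (leftSymbol i t (reflect d b)) * daggerZ i t d (reflect d a) := by
    rw [← reflect₂_symbZ_mul h, ← neg_neg (reflect₂ t _ * _), ← reflect₂_mul_sub,
      ← mul_assoc, ← mul_assoc, sub_mul_symbZ h, sub_mul, sub_mul, mul_assoc (symbZ i a), mul_invSub,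
      mul_one, reflect₂_sub]
    abel
  rw [add_mul, h1, mul_assoc (lconst _ * invSub t), daggerZ_reflect_mul_sub h, mul_add,
    mul_assoc (lconst _) (invSub t) (_ * _), ← mul_assoc (invSub t), invSub_mul, one_mul]
  abel

include h in
theorem reflect₂_adlerSer (a b : Laurent V) :
    reflect₂ t (adlerSer i t d a b) = adlerSer i t d (reflect d b) (reflect d a) := by
  -- The image of the other Adler term comes for free: apply the same formula to the adjoints and
  -- use that all reflections are involutions.
  have h1 := congrArg (reflect₂ t) (reflect₂_symbZ_mul_invSub h (reflect d b) (reflect d a))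
  rw [reflect₂_reflect₂, reflect_reflect, reflect_reflect] at h1
  rw [reflect₂_neg] at h1
  rw [adlerSer, reflect₂_sub, reflect₂_symbZ_mul_invSub h, neg_eq_iff_eq_neg.1 h1.symm, adlerSer]
  abel

include h in
theorem RingBracket.IsAdlerSer.adjoint {B : RingBracket i t d} {m n : Type*}
    {A : m → n → Laurent V} (hA : B.IsAdlerSer A) :
    B.IsAdlerSer fun q p => reflect d (A p q) := by
  intro p q r s
  rw [B.ser_reflect, hA]
  exact reflect₂_adlerSer h _ _

end Reflect

/-! ### Products and inverses -/

section Matrix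

variable (h : ∀ a, t * i a = i a * t + i (d a))

theorem adlerSer_sum_left {κ : Type*} (s : Finset κ) (a : κ → Laurent V) (b : Laurent V) :
    adlerSer i t d (∑ k ∈ s, a k) b = ∑ k ∈ s, adlerSer i t d (a k) b := by
  simp only [adlerSer, map_sum, Finset.sum_mul, Finset.sum_sub_distrib]

theorem adlerSer_sum_right {κ : Type*} (s : Finset κ) (a : Laurent V) (b : κ → Laurent V) :
    adlerSer i t d a (∑ k ∈ s, b k) = ∑ k ∈ s, adlerSer i t d a (b k) := by
  simp only [adlerSer, map_sum, Finset.mul_sum, Finset.sum_sub_distrib]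

include h in
-- The middle term is added and subtracted, so that the Adler expression of the inner factors `b`,
-- `b'` appears between the symbols of `a` and `a'`.
theorem adlerSer_opComp (a a' b b' : Laurent V) :
    adlerSer i t d (opComp d b a) (opComp d b' a') =
      lconst (leftSymbol i t a) * adlerSer i t d b b' * daggerZ i t d a' +
      lconst (leftSymbol i t a) * symbZ i b * invSub t * lconst (symb i b') * daggerZ i t d a' -
      symbZ i (opComp d b a) * invSub t * lconst (symb i (opComp d b' a')) := by
  rw [adlerSer, adlerSer, leftSymbol_opComp h, dagger_opComp (lconst_mul_comm_rel h), map_mul]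
  noncomm_ring

include h in
theorem RingBracket.IsAdlerSer.mul {B : RingBracket i t d} {m n p : Type*} [Fintype n]
    {A : m → n → Laurent V} {A' : n → p → Laurent V} (hA : B.IsAdlerSer A) (hA' : B.IsAdlerSer A')
    (h1 : ∀ x y z w, B.ser (A x y) (A' z w) = 0) (h2 : ∀ x y z w, B.ser (A' z w) (A x y) = 0) :
    B.IsAdlerSer fun x z => ∑ y, opComp d (A' y z) (A x y) := by
  intro x z x' z'
  have key : ∀ y y', B.ser (opComp d (A' y z) (A x y)) (opComp d (A' y' z') (A x' y')) =
      lconst (leftSymbol i t (A x' y')) * adlerSer i t d (A' y' z) (A' y z') *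
        daggerZ i t d (A x y) +
      lmap (substLeft i d (A' y' z')) (substRight (lconst.comp i) d (A' y z)
        (adlerSer i t d (A x' y) (A x y'))) := by
    intro y y'
    rw [B.ser_opComp_right, B.ser_opComp_left h, B.ser_opComp_left h, h1, h2, hA, hA', map_zero,
      zero_mul, add_zero, zero_add, mul_assoc]
  simp only [map_sum, AddMonoidHom.finsetSum_apply, adlerSer_sum_left, adlerSer_sum_right, key, substLeft_substRight_adlerSer h, adlerSer_opComp h,
    Finset.sum_add_distrib, Finset.sum_sub_distrib]
  rw [add_sub_assoc]
  -- The Leibniz rule pairs the two inner indices oppositely in the terms from `A'` and from `A`;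
  -- exchanging them in the first sum is what matches the middle terms.
  refine congrArg₂ (· + ·) Finset.sum_comm ?_
  simp only [mul_assoc]

include h in
-- The bracket of `A∘A' = 1` with `c` vanishes; by the Leibniz rule this is a linear system for the
-- brackets of `A'`, with right coefficients the adjoint symbols of `A`. It is solved by those of
-- `A'`, because `A'∘A = 1`.
theorem RingBracket.ser_inverse_left (B : RingBracket i t d) {n : Type*} [Fintype n]
    [DecidableEq n] {A A' : n → n → Laurent V}
    (h1 : ∀ x z, ∑ y, opComp d (A' y z) (A x y) = if x = z then 1 else 0)
    (h2 : ∀ x z, ∑ y, opComp d (A y z) (A' x y) = if x = z then 1 else 0) (x y : n)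
    (c : Laurent V) :
    B.ser (A' x y) c = -∑ r, (∑ s, substRight (lconst.comp i) d (A' s y) (B.ser (A r s) c)) *
      daggerZ i t d (A' x r) := by
  have e1 : ∀ r, ∑ s, B.ser (A' s y) c * daggerZ i t d (A r s) +
      ∑ s, substRight (lconst.comp i) d (A' s y) (B.ser (A r s) c) = 0 := by
    intro r
    rw [← Finset.sum_add_distrib]
    simp only [← B.ser_opComp_left h]
    rw [← AddMonoidHom.finsetSum_apply, ← map_sum, h1]
    split_ifs
    · exact B.ser_one_left c
    · simp
  have e2 : ∀ s, ∑ r, daggerZ i t d (A r s) * daggerZ i t d (A' x r) =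
      if x = s then 1 else 0 := by
    intro s
    simp only [← dagger_opComp (lconst_mul_comm_rel h)]
    rw [← map_sum, h2]
    split_ifs
    · rw [← map_one lconst, dagger_lconst (lconst_mul_comm_rel h), map_one, map_one]
    · simp
  have e3 : B.ser (A' x y) c =
      ∑ r, (∑ s, B.ser (A' s y) c * daggerZ i t d (A r s)) * daggerZ i t d (A' x r) := by
    calc B.ser (A' x y) c
        = ∑ s, B.ser (A' s y) c * ∑ r, daggerZ i t d (A r s) * daggerZ i t d (A' x r) := by
          simp [e2]
      _ = _ := by
          simp only [Finset.mul_sum, Finset.sum_mul, mul_assoc]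
          exact Finset.sum_comm
  rw [eq_neg_iff_add_eq_zero, e3, ← Finset.sum_add_distrib]
  exact Finset.sum_eq_zero fun r _ => by rw [← add_mul, e1, zero_mul]

include h in
-- The same linear system in the second slot, now with left coefficients `A(w + t)`, inverted by
-- `A'(w + t)`.
theorem RingBracket.ser_inverse_right (B : RingBracket i t d) {n : Type*} [Fintype n]
    [DecidableEq n] {A A' : n → n → Laurent V}
    (h1 : ∀ x z, ∑ y, opComp d (A' y z) (A x y) = if x = z then 1 else 0)
    (h2 : ∀ x z, ∑ y, opComp d (A y z) (A' x y) = if x = z then 1 else 0) (x y : n)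
    (c : Laurent V) :
    B.ser c (A' x y) = -∑ r, lconst (leftSymbol i t (A' x r)) *
      ∑ s, lmap (substLeft i d (A' s y)) (B.ser c (A r s)) := by
  have e1 : ∀ r, ∑ s, lconst (leftSymbol i t (A r s)) * B.ser c (A' s y) =
      -∑ s, lmap (substLeft i d (A' s y)) (B.ser c (A r s)) := by
    intro r
    rw [eq_neg_iff_add_eq_zero, ← Finset.sum_add_distrib]
    simp only [← B.ser_opComp_right]
    rw [← map_sum, h1]
    split_ifs
    · exact B.ser_one_right c
    · simp
  have e2 : ∀ s, ∑ r, lconst (leftSymbol i t (A' x r)) * lconst (leftSymbol i t (A r s)) =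
      if x = s then 1 else 0 := by
    intro s
    simp only [← map_mul, ← leftSymbol_opComp h]
    rw [← map_sum, ← map_sum, h2]
    split_ifs
    · rw [← map_one lconst, leftSymbol_lconst, map_one, map_one, map_one]
    · simp
  calc B.ser c (A' x y)
      = ∑ s, (∑ r, lconst (leftSymbol i t (A' x r)) * lconst (leftSymbol i t (A r s))) *
          B.ser c (A' s y) := by
        simp [e2]
    _ = ∑ r, lconst (leftSymbol i t (A' x r)) *
          ∑ s, lconst (leftSymbol i t (A r s)) * B.ser c (A' s y) := by
        simp only [Finset.mul_sum, Finset.sum_mul, mul_assoc]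
        exact Finset.sum_comm
    _ = _ := by
        rw [← Finset.sum_neg_distrib]
        exact Finset.sum_congr rfl fun r _ => by rw [e1]; exact mul_neg _ _

include h in
theorem RingBracket.IsAdlerSer.inverse {B : RingBracket i t d} {n : Type*} [Fintype n]
    [DecidableEq n] {A A' : n → n → Laurent V} (hA : B.IsAdlerSer A)
    (h1 : ∀ x z, ∑ y, opComp d (A' y z) (A x y) = if x = z then 1 else 0)
    (h2 : ∀ x z, ∑ y, opComp d (A y z) (A' x y) = if x = z then 1 else 0) (x y x' y' : n) :
    B.ser (A' x y) (A' x' y') = -adlerSer i t d (A' x' y) (A' x y') := by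
  have e1 : ∀ s, ∑ r, daggerZ i t d (A r s) * daggerZ i t d (A' x r) =
      if x = s then 1 else 0 := by
    intro s
    simp only [← dagger_opComp (lconst_mul_comm_rel h)]
    rw [← map_sum, h2]
    split_ifs
    · rw [← map_one lconst, dagger_lconst (lconst_mul_comm_rel h), map_one, map_one]
    · simp
  have e2 : ∀ s, ∑ r, lconst (leftSymbol i t (A' x' r)) * lconst (leftSymbol i t (A r s)) =
      if x' = s then 1 else 0 := by
    intro s
    simp only [← map_mul, ← leftSymbol_opComp h]
    rw [← map_sum, ← map_sum, h2]
    split_ifs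
    · rw [← map_one lconst, leftSymbol_lconst, map_one, map_one, map_one]
    · simp
  have e3 : ∀ s, ∑ r, symbZ i (opComp d (A' r y) (A s r)) = if s = y then 1 else 0 := by
    intro s
    rw [← map_sum, h1]
    split_ifs
    · exact lmap_one _
    · simp
  have e4 : ∀ s, ∑ r, lconst (symb i (opComp d (A' r y') (A s r))) =
      if s = y' then (1 : Laurent (Laurent E)) else 0 := by
    intro s
    rw [← map_sum, ← map_sum, h1]
    split_ifs
    · rw [symb, lmap_one, map_one]
    · simp
  -- Inversion in the first slot only: in each Adler term one sum over a composition of `A` and `A'`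
  -- collapses to a Kronecker delta.
  have key : ∀ r s, B.ser (A' x y) (A r s) =
      (if r = y then 1 else 0) * (invSub t * ∑ k, lconst (symb i (A k s)) * daggerZ i t d (A' x k)) -
      (∑ k, lconst (leftSymbol i t (A r k)) * symbZ i (A' k y)) * (invSub t *
        if x = s then 1 else 0) := by
    intro r s
    rw [B.ser_inverse_left h h1 h2, ← e3, ← e1]
    simp only [hA _ _ _ _, substRight_adlerSer h, Finset.sum_sub_distrib, Finset.sum_mul, sub_mul,
      Finset.mul_sum, neg_sub, mul_assoc]
  have e5 : ∀ r s, lmap (substLeft i d (A' s y')) (B.ser (A' x y) (A r s)) =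
      (if r = y then 1 else 0) * (invSub t *
        ∑ k, lconst (symb i (opComp d (A' s y') (A k s))) * daggerZ i t d (A' x k)) -
      (∑ k, lconst (leftSymbol i t (A r k)) * symbZ i (A' k y)) * (invSub t *
        if x = s then lconst (symb i (A' s y')) else 0) := by
    intro r s
    rw [key, map_sub]
    congr 1
    · split_ifs
      · rw [one_mul, one_mul, substLeft_lmap_invSub h, map_sum]
        simp only [substLeft_lmap_mul_daggerZ, lmap_lconst_apply, substLeft_symb]
      · rw [zero_mul, zero_mul, map_zero]
    · rw [Finset.sum_mul, map_sum, Finset.sum_mul]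
      refine Finset.sum_congr rfl fun k _ => ?_
      rw [mul_assoc, mul_assoc, substLeft_lmap_lconst_leftSymbol h, substLeft_lmap_symbZ,
        substLeft_lmap_invSub h]
      split_ifs
      · rw [← map_one lconst, lmap_lconst_apply, substLeft_one]
      · rw [map_zero]
  have e6 : ∀ r, ∑ s, lmap (substLeft i d (A' s y')) (B.ser (A' x y) (A r s)) =
      (if r = y then 1 else 0) * (invSub t * daggerZ i t d (A' x y')) -
      (∑ k, lconst (leftSymbol i t (A r k)) * symbZ i (A' k y)) *
        (invSub t * lconst (symb i (A' x y'))) := by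
    intro r
    simp only [e5, Finset.sum_sub_distrib, ← Finset.mul_sum, Finset.sum_ite_eq, Finset.mem_univ,
      if_true]
    rw [Finset.sum_comm]
    simp only [← Finset.sum_mul, e4, ite_mul, one_mul, zero_mul, Finset.sum_ite_eq',
      Finset.mem_univ, if_true]
  -- The symbols `A'(w + t) A(w + t)` multiply to the identity, which leaves the bare `A'(z)`.
  have e7 : ∑ r, lconst (leftSymbol i t (A' x' r)) *
      ∑ k, lconst (leftSymbol i t (A r k)) * symbZ i (A' k y) = symbZ i (A' x' y) := by
    simp only [Finset.mul_sum, ← mul_assoc]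
    rw [Finset.sum_comm]
    simp only [← Finset.sum_mul, e2, ite_mul, one_mul, zero_mul, Finset.sum_ite_eq,
      Finset.mem_univ, if_true]
  rw [B.ser_inverse_right h h1 h2]
  simp only [e6, mul_sub, Finset.sum_sub_distrib, ← mul_assoc]
  rw [adlerSer, ← e7]
  simp only [← Finset.sum_mul, mul_ite, mul_one, mul_zero, Finset.sum_ite_eq',
    Finset.mem_univ, if_true]

end Matrix

end Adler

/-! ### Coefficient formulas -/

section Coefficients

variable {V W : Type*} [CommRing V] [AddCommGroup W] [Module V W]

/-- `(z + T)ⁿ` applied to a constant has degree at most `n`, so only `n = s + l` with `l ≥ 0`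
contributes to `z^s`, through the single binomial term `l = n - s`. -/
theorem coef_reflect_eq (T : AddMonoid.End W) (f : Laurent W) (s : ℤ) :
    coef (reflect T f) s = ∑ᶠ l : ℕ, ((s + l).negOnePow : ℤ) • (Ring.choose (s + l) l •
      (T ^ l) (coef f (s + l))) := by
  have h1 : ∀ n : ℤ, coef (shiftPow T n (mono 0 (coef f n))) s =
      if s ≤ n then Ring.choose n (n - s).toNat • (T ^ (n - s).toNat) (coef f n) else 0 := by
    intro n
    split_ifs with h
    · rw [coef_shiftPow, finsum_eq_single _ (n - s).toNat]
      · rw [show s - n + ((n - s).toNat : ℤ) = 0 by omega, coef_mono_self]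
      · intro k hk
        rw [coef_mono_of_ne (by omega), map_zero, smul_zero]
    · exact shiftPow_bound T n (N := 0) (fun m hm => coef_mono_of_ne (by omega) _) s (by omega)
  have hinj : Function.Injective fun l : ℕ => s + (l : ℤ) := fun a b h => by simpa using h
  rw [coef_reflect]
  simp only [h1]
  refine (finsum_mem_univ _).symm.trans ((finsum_mem_inter_support_eq' _ Set.univ
    (Set.range fun l : ℕ => s + (l : ℤ)) fun n hn => ?_).trans ((finsum_mem_range hinj).trans ?_))
  · refine iff_of_true trivial ?_
    by_contra h
    refine hn ?_
    beta_reduce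
    rw [if_neg, smul_zero]
    exact fun hle => h ⟨(n - s).toNat, by simp; omega⟩
  · refine finsum_congr fun l => ?_
    rw [if_pos (by omega), add_sub_cancel_left, Int.toNat_natCast]

theorem coef_finsum {ι : Type*} {f : ι → Laurent W} (hf : (Function.support f).Finite) (q : ℤ) :
    coef (∑ᶠ i, f i) q = ∑ᶠ i, coef (f i) q :=
  (coefHom q).map_finsum hf

theorem shiftApply_eq (T : AddMonoid.End W) {a : ℤ → V} {g : ℤ → W} {N M : ℤ}
    (hN : ∀ n, N < n → a n = 0) (hM : ∀ n, M < n → g n = 0) (q : ℤ) :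
    shiftApply T a g q =
      ∑ᶠ n : ℤ, a n • ∑ᶠ k : ℕ, Ring.choose n k • (T ^ k) (g (q - n + k)) := by
  rw [shiftApply, finsum_curry]
  · refine finsum_congr fun n => ?_
    rw [smul_finsum']
    refine (Set.finite_Iio ((M - q + n).toNat + 1)).subset fun k hk => ?_
    by_contra h
    simp only [Set.mem_Iio, not_lt] at h
    exact hk (by simp [hM (q - n + k) (by omega)])
  -- Currying a `finsum` needs finite support: the bound on `a` gives `n ≤ N`, the bound on `g`
  -- gives `q - n + k ≤ M`, and with `k ≥ 0` both indices are confined to a box.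
  · refine ((Set.finite_Icc (q - M) N).prod (Set.finite_Iio ((M - q + N).toNat + 1))).subset ?_
    rintro ⟨n, k⟩ hk
    have h1 : n ≤ N := by
      by_contra h
      exact hk (by simp [hN n (by omega)])
    have h2 : q - n + k ≤ M := by
      by_contra h
      exact hk (by simp [hM (q - n + k) (by omega)])
    simp only [Set.mem_prod, Set.mem_Icc, Set.mem_Iio]
    omega

end Coefficients

/-! ### From pseudodifferential operators and `λ`-brackets to series over `E` -/

section PDO

variable {F V : Type*} [Field F] [CommRing V] [Algebra F V] (D : Derivation F V V)

theorem PDO.exists_bound (a : PDO V) : ∃ N : ℤ, ∀ n, N < n → a.1 n = 0 := a.2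

/-- A pseudodifferential operator as a Laurent series. -/
def PDO.toLaurent : PDO V →+ Laurent V where
  toFun a := ofCoef a.1 a.exists_bound
  map_zero' := coef_ext fun q => by simp
  map_add' a b := coef_ext fun q => by simp

@[simp] theorem PDO.coef_toLaurent (a : PDO V) (q : ℤ) : coef (PDO.toLaurent a) q = a.1 q := by
  simp [PDO.toLaurent]

theorem PDO.toLaurent_const (c : V) : PDO.toLaurent (PDO.const c) = lconst c :=
  coef_ext fun q => by rw [PDO.coef_toLaurent, coef_lconst]; rfl

theorem PDO.toLaurent_comp (a b : PDO V) :
    PDO.toLaurent (PDO.comp D a b) = opComp (derEnd D) b.toLaurent a.toLaurent := by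
  refine coef_ext fun q => ?_
  obtain ⟨N, hN⟩ := a.2
  obtain ⟨M, hM⟩ := b.2
  rw [PDO.coef_toLaurent, coef_opComp]
  exact (shiftApply_eq (derEnd D) hN hM q).trans
    (finsum_congr fun n => by simp [coef_shiftPow])

theorem derEnd_pow_apply (k : ℕ) (x : V) : (derEnd D ^ k) x = D^[k] x := by
  induction k generalizing x with
  | zero => simp
  | succ k ih => rw [pow_succ, end_mul_apply, ih, Function.iterate_succ_apply]; rfl

theorem PDO.toLaurent_adjoint (a : PDO V) :
    PDO.toLaurent (PDO.adjoint D a) = reflect (derEnd D) a.toLaurent := by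
  refine coef_ext fun q => ?_
  rw [PDO.coef_toLaurent, coef_reflect_eq]
  exact finsum_congr fun k => by simp [derEnd_pow_apply]

/-! ### Polynomials in `λ` as operators -/

theorem coeff_lamAdd (P : V[X]) (n : ℕ) :
    (lamAdd D P).coeff n = (X * P).coeff n + D (P.coeff n) := by
  change (X * P + P.sum fun n c => monomial n (D c)).coeff n = _
  rw [coeff_add, Polynomial.sum_def, finsetSum_coeff]
  simp only [coeff_monomial, Finset.sum_ite_eq', mem_support_iff]
  split_ifs with h
  · rfl
  · rw [notMem_support_iff.1 h, map_zero]

theorem lamAdd_smul (a : V) (P : V[X]) : lamAdd D (a • P) = a • lamAdd D P + D a • P := by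
  ext n
  simp only [coeff_lamAdd, coeff_add, coeff_smul, mul_smul_comm, smul_eq_mul, Derivation.leibniz]
  ring

theorem lamAdd_X_pow (n : ℕ) : lamAdd D (X ^ n) = X ^ (n + 1) := by
  ext m
  rw [coeff_lamAdd, ← pow_succ', coeff_X_pow n]
  split_ifs <;> simp

variable (V) in
/-- The scalars acting on `V[λ]`. -/
abbrev scalarEnd : V →+* AddMonoid.End V[X] := Module.toAddMonoidEnd V V[X]

theorem lamAdd_mul_scalarEnd (a : V) :
    lamAdd D * scalarEnd V a = scalarEnd V a * lamAdd D + scalarEnd V (derEnd D a) := by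
  refine AddMonoidHom.ext fun P => ?_
  exact lamAdd_smul D a P

/-- The polynomial `∑ pₙ λⁿ` as the operator `∑ pₙ (λ + ∂)ⁿ` on `V[λ]`. -/
def polyEnd : V[X] →+ AddMonoid.End V[X] := eval₂AddMonoidHom (scalarEnd V) (lamAdd D)

theorem polyEnd_monomial (n : ℕ) (c : V) :
    polyEnd D (monomial n c) = scalarEnd V c * lamAdd D ^ n := eval₂_monomial _ _

theorem polyEnd_C (c : V) : polyEnd D (C c) = scalarEnd V c := eval₂_C _ _

theorem polyEnd_X_mul (P : V[X]) : polyEnd D (X * P) = polyEnd D P * lamAdd D := by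
  rw [mul_comm]; exact eval₂_mul_X _ _

theorem polyEnd_C_mul (c : V) (P : V[X]) : polyEnd D (C c * P) = scalarEnd V c * polyEnd D P := by
  induction P using Polynomial.induction_on' with
  | add P Q hP hQ => rw [mul_add, map_add, map_add, hP, hQ, mul_add]
  | monomial n a => rw [C_mul_monomial, polyEnd_monomial, polyEnd_monomial, map_mul, mul_assoc]

theorem polyEnd_smul (c : V) (P : V[X]) : polyEnd D (c • P) = scalarEnd V c * polyEnd D P := by
  rw [smul_eq_C_mul, polyEnd_C_mul]

theorem lamAdd_monomial (n : ℕ) (a : V) :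
    lamAdd D (monomial n a) = monomial (n + 1) a + monomial n (D a) := by
  rw [← mul_one a, ← smul_eq_mul, ← smul_monomial, ← X_pow_eq_monomial, lamAdd_smul, lamAdd_X_pow]
  simp [smul_eq_C_mul, C_mul_X_pow_eq_monomial]

/-- Passing `λ + ∂` over a coefficient on the left creates its derivative; this is exactly the
action of `λ + ∂` on polynomials. -/
theorem polyEnd_lamAdd (P : V[X]) : polyEnd D (lamAdd D P) = lamAdd D * polyEnd D P := by
  induction P using Polynomial.induction_on' with
  | add P Q hP hQ => rw [map_add, map_add, map_add, hP, hQ, mul_add]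
  | monomial n a =>
    rw [lamAdd_monomial, map_add, polyEnd_monomial, polyEnd_monomial, polyEnd_monomial, ← mul_assoc,
      lamAdd_mul_scalarEnd, add_mul, pow_succ', mul_assoc]
    rfl

theorem polyEnd_lamAdd_pow (n : ℕ) (P : V[X]) :
    polyEnd D ((lamAdd D ^ n) P) = lamAdd D ^ n * polyEnd D P := by
  induction n with
  | zero => simp
  | succ n ih => rw [pow_succ', end_mul_apply, polyEnd_lamAdd, ih, mul_assoc]

/-- Both sides are `∑ pₙ (λ+∂)ⁿ b` as operators. This makes the Leibniz rule in the first slot an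
ordinary right multiplication. -/
theorem polyEnd_shiftEval (P : V[X]) (b : V) :
    polyEnd D (shiftEval D P b) = polyEnd D P * scalarEnd V b := by
  have h1 : polyEnd D P = P.sum fun n c => scalarEnd V c * lamAdd D ^ n := eval₂_eq_sum
  rw [h1, shiftEval, Polynomial.sum_def, Polynomial.sum_def, map_sum, Finset.sum_mul]
  refine Finset.sum_congr rfl fun n _ => ?_
  rw [polyEnd_C_mul, polyEnd_lamAdd_pow, polyEnd_C, mul_assoc]

/-- Since `∂ 1 = 0`, `(λ + ∂)ⁿ 1 = λⁿ`; hence nothing is lost by passing to operators. -/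
theorem polyEnd_apply_one (P : V[X]) : polyEnd D P 1 = P := by
  induction P using Polynomial.induction_on' with
  | add P Q hP hQ => rw [map_add]; exact congrArg₂ (· + ·) hP hQ
  | monomial n a =>
    have h1 : (lamAdd D ^ n) (1 : V[X]) = X ^ n := by
      induction n with
      | zero => simp
      | succ n ih => rw [pow_succ', end_mul_apply, ih, lamAdd_X_pow]
    rw [polyEnd_monomial, end_mul_apply, h1]
    change a • X ^ n = _
    rw [smul_eq_C_mul, C_mul_X_pow_eq_monomial]

theorem polyEnd_injective : Function.Injective (polyEnd D) := fun P Q h => by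
  rw [← polyEnd_apply_one D P, h, polyEnd_apply_one]

variable (V) in
/-- The ring of additive operators on `V[λ]`. -/
def OpEnd := AddMonoid.End V[X]

instance : Ring (OpEnd V) := inferInstanceAs (Ring (AddMonoid.End V[X]))

variable (V) in
/-- The scalars acting on `V[λ]`. -/
def scalarOp : V →+* OpEnd V := scalarEnd V

/-- The operator `λ + ∂` on `V[λ]`. -/
def lamOp : OpEnd V := lamAdd D

/-- The polynomial `∑ pₙ λⁿ` as the operator `∑ pₙ (λ + ∂)ⁿ` on `V[λ]`. -/
def polyOp : V[X] →+ OpEnd V := polyEnd D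

theorem lamOp_mul_scalarOp (a : V) :
    lamOp D * scalarOp V a = scalarOp V a * lamOp D + scalarOp V (derEnd D a) :=
  lamAdd_mul_scalarEnd D a

theorem polyOp_monomial (n : ℕ) (c : V) :
    polyOp D (monomial n c) = scalarOp V c * lamOp D ^ n := polyEnd_monomial D n c

theorem polyOp_C (c : V) : polyOp D (C c) = scalarOp V c := polyEnd_C D c

theorem polyOp_X_mul (P : V[X]) : polyOp D (X * P) = polyOp D P * lamOp D := polyEnd_X_mul D P

theorem polyOp_C_mul (c : V) (P : V[X]) : polyOp D (C c * P) = scalarOp V c * polyOp D P :=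
  polyEnd_C_mul D c P

theorem polyOp_smul (c : V) (P : V[X]) : polyOp D (c • P) = scalarOp V c * polyOp D P :=
  polyEnd_smul D c P

theorem polyOp_lamAdd (P : V[X]) : polyOp D (lamAdd D P) = lamOp D * polyOp D P :=
  polyEnd_lamAdd D P

theorem polyOp_lamAdd_pow (n : ℕ) (P : V[X]) :
    polyOp D ((lamAdd D ^ n) P) = lamOp D ^ n * polyOp D P := polyEnd_lamAdd_pow D n P

theorem polyOp_shiftEval (P : V[X]) (b : V) :
    polyOp D (shiftEval D P b) = polyOp D P * scalarOp V b := polyEnd_shiftEval D P b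

theorem polyOp_injective : Function.Injective (polyOp D) := polyEnd_injective D

variable {D} in
/-- A `λ`-bracket, with values in operators. -/
def LambdaBracket.toRingBracket (L : LambdaBracket D) :
    RingBracket (scalarOp V) (lamOp D) (derEnd D) where
  br := AddMonoidHom.mk' (fun a => AddMonoidHom.mk' (fun b => polyOp D (L.br a b))
    fun b b' => by simp) fun a a' => AddMonoidHom.ext fun b => by simp
  der_left a b := by
    change polyOp D (L.br (D a) b) = -(polyOp D (L.br a b) * lamOp D)
    rw [L.sesq_left, map_neg, polyOp_X_mul]
  der_right a b := by
    change polyOp D (L.br a (D b)) = lamOp D * polyOp D (L.br a b)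
    rw [L.sesq_right, polyOp_lamAdd]
  mul_right a b c := by
    change polyOp D (L.br a (b * c)) =
      scalarOp V c * polyOp D (L.br a b) + scalarOp V b * polyOp D (L.br a c)
    rw [L.leibniz_left, map_add, mul_comm _ (C c), mul_comm _ (C b), polyOp_C_mul, polyOp_C_mul]
  mul_left a b c := by
    change polyOp D (L.br (a * b) c) =
      polyOp D (L.br a c) * scalarOp V b + polyOp D (L.br b c) * scalarOp V a
    rw [L.leibniz_right, map_add, polyOp_shiftEval, polyOp_shiftEval]

theorem LambdaBracket.toRingBracket_br {D : Derivation F V V} (L : LambdaBracket D) (a b : V) :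
    L.toRingBracket.br a b = polyOp D (L.br a b) := rfl

/-! ### Comparison of the two forms of the Adler identity -/

/-- `G` is the image under `polyOp` of the double series `g`. -/
def Represents (G : Laurent (Laurent (OpEnd V))) (g : ℤ → ℤ → V[X]) : Prop :=
  ∀ p q, coef (coef G p) q = polyOp D (g p q)

variable {D}

theorem Represents.wAdd {G : Laurent (Laurent (OpEnd V))} {g : ℤ → ℤ → V[X]}
    (hG : Represents D G g) :
    Represents D (lconst (zvar + lconst (lamOp D)) * G) (wAdd (lamAdd D) g) := by
  intro p q
  rw [coef_lconst_mul, ← addVar_mulL, coef_addVar, hG, hG, mulL_apply, AdlerType.wAdd, map_add,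
    polyOp_lamAdd]

theorem Represents.wAdd_iterate {G : Laurent (Laurent (OpEnd V))} {g : ℤ → ℤ → V[X]}
    (hG : Represents D G g) (k : ℕ) :
    Represents D (lconst ((zvar + lconst (lamOp D)) ^ k) * G)
      ((AdlerType.wAdd (lamAdd D))^[k] g) := by
  induction k with
  | zero => simpa using hG
  | succ k ih =>
    rw [Function.iterate_succ_apply', pow_succ', map_mul, mul_assoc]
    exact ih.wAdd

/-- Since `(-1 choose k) = (-1)ᵏ`, the binomial series of `(z - s)⁻¹` is the geometric series. -/
theorem choose_neg_one_smul_pow {K : Type*} [Ring K] (s : K) (k : ℕ) (x : K) :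
    Ring.choose (-1 : ℤ) k • ((-s) ^ k * x) = s ^ k * x := by
  have h1 : Ring.choose (-1 : ℤ) k = (-1) ^ k := by
    rw [Ring.choose_neg', Ring.multichoose_one, Units.smul_def, smul_eq_mul, mul_one]
    simp [Int.negOnePow_def]
  rw [h1, neg_pow s, zsmul_eq_mul, ← mul_assoc, ← mul_assoc]
  rcases Nat.even_or_odd k with hk | hk <;> simp [hk.neg_pow]

theorem Represents.iotaInv {G : Laurent (Laurent (OpEnd V))} {g : ℤ → ℤ → V[X]}
    (hG : Represents D G g) :
    Represents D (invSub (lamOp D) * G) (iotaInv (lamAdd D) g) := by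
  intro p q
  obtain ⟨N, hN⟩ := exists_coef_eq_zero (W := Laurent (OpEnd V)) G
  -- Injectivity of `polyOp` lets it pass through a `finsum` with no finiteness check.
  rw [invSub, ← shiftPow_mulL, coef_shiftPow, AdlerType.iotaInv,
    (polyOp D).map_finsum_of_injective (polyOp_injective D)]
  simp only [mulL_pow_apply, choose_neg_one_smul_pow]
  refine (coef_finsum ?_ q).trans (finsum_congr fun k => ?_)
  · refine (Set.finite_Iio ((N - p).toNat + 1)).subset fun k hk => ?_
    by_contra h
    simp only [Set.mem_Iio, not_lt] at h
    exact hk (by beta_reduce; rw [hN (p - -1 + k) (by omega), mul_zero])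
  · rw [← hG.wAdd_iterate k, coef_lconst_mul, show p - -1 + (k : ℤ) = p + k + 1 by ring]

theorem Represents.mulZ {G : Laurent (Laurent (OpEnd V))} {g : ℤ → ℤ → V[X]}
    (hG : Represents D G g) (a : PDO V) :
    Represents D (symbZ (scalarOp V) a.toLaurent * G) (mulZ a.1 g) := by
  intro p q
  obtain ⟨N, hN⟩ := exists_coef_eq_zero (W := Laurent (OpEnd V)) G
  obtain ⟨M, hM⟩ := a.2
  rw [coef_mul, AdlerType.mulZ, (polyOp D).map_finsum_of_injective (polyOp_injective D)]
  refine (coef_finsum ?_ q).trans (finsum_congr fun n => ?_)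
  · refine (Set.finite_Icc (p - N) M).subset fun n hn => ?_
    constructor
    · by_contra h
      exact hn (by simp [hN (p - n) (by omega)])
    · by_contra h
      exact hn (by simp [hM n (by omega)])
  · rw [polyOp_smul, ← hG, coef_symb, PDO.coef_toLaurent]
    exact coef_lconst_mul _ _ _

theorem coef_leftSymbol_mul {E : Type*} [Ring E] (i : V →+* E) (t : E) (a : Laurent V)
    (f : Laurent E) (q : ℤ) :
    coef (leftSymbol i t a * f) q =
      ∑ᶠ n : ℤ, i (coef a n) * coef (shiftPow (mulL t) n f) q := by
  obtain ⟨N, hN⟩ := exists_coef_eq_zero f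
  have hb : ∃ c : ℤ, ∀ n e q, n + c < q → coef (((AddMonoidHom.mulRight (shiftPow (mulL t) n f)).comp
    (((lconst : E →+* Laurent E).comp i : V →+* Laurent E) : V →+ Laurent E)) e) q = 0 :=
    ⟨N, fun n e q hq => by simp [shiftPow_bound (mulL t) n hN q hq]⟩
  have h1 : leftSymbol i t a * f = sumMap _ hb a := by
    refine IsBounded.ext ((IsBounded.mulRight f).comp (.leftSymbol i t)) (.sumMap _ hb)
      (fun n e => ?_) a
    rw [sumMap_mono, leftSymbol_mono, mul_assoc, ← shiftPow_mulL]
    rfl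
  rw [h1, coef_sumMap]
  exact finsum_congr fun n => coef_lconst_mul _ _ _

theorem Represents.shiftApply {G : Laurent (Laurent (OpEnd V))} {g : ℤ → ℤ → V[X]}
    (hG : Represents D G g) (a : PDO V) :
    Represents D (lconst (leftSymbol (scalarOp V) (lamOp D) a.toLaurent) * G)
      fun p q => shiftApply (lamAdd D) a.1 (g p) q := by
  intro p q
  obtain ⟨M, hM⟩ := a.2
  obtain ⟨N, hN⟩ := exists_coef_eq_zero (coef G p)
  have hg : ∀ n, N < n → g p n = 0 := fun n hn =>
    polyOp_injective D (by rw [← hG, hN n hn, map_zero])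
  rw [coef_lconst_mul, coef_leftSymbol_mul]
  beta_reduce
  rw [shiftApply_eq _ hM hg,
    (polyOp D).map_finsum_of_injective (polyOp_injective D)]
  refine finsum_congr fun n => ?_
  rw [polyOp_smul, coef_shiftPow, (polyOp D).map_finsum_of_injective (polyOp_injective D),
    PDO.coef_toLaurent]
  congr 1
  refine finsum_congr fun k => ?_
  rw [map_zsmul, polyOp_lamAdd_pow, ← hG, mulL_pow_apply]

theorem represents_inW (b : PDO V) :
    Represents D (lconst (symb (scalarOp V) b.toLaurent)) (inW fun r => C (b.1 r)) := by
  intro p q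
  rw [coef_lconst, inW]
  split_ifs
  · simp [polyOp_C]
  · simp

theorem coef_dagger_eq (b : PDO V) (s : ℤ) :
    coef (dagger (scalarOp V) (lamOp D) (derEnd D) b.toLaurent) s =
      polyOp D (lamSub (PDO.adjoint D b) s) := by
  rw [dagger_apply, ← PDO.toLaurent_adjoint, coef_reflect_eq, lamSub,
    (polyOp D).map_finsum_of_injective (polyOp_injective D)]
  refine finsum_congr fun l => ?_
  rw [map_zsmul, map_zsmul, C_mul_X_pow_eq_monomial, polyOp_monomial, mulR_pow_apply, coef_symb,
    -- The reflection carries the sign `(-1)^(s+l)` and `(-t)ˡ` the sign `(-1)ˡ`; the product is the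
    -- `(-1)^s` of `(λ - z)^(s+l)`.
    PDO.coef_toLaurent, Int.negOnePow_add]
  have h1 : Even (l : ℤ) ↔ Even l := Int.even_coe_nat l
  have h2 : Odd (l : ℤ) ↔ Odd l := Int.odd_coe_nat l
  rcases Nat.even_or_odd l with hl | hl
  · rw [hl.neg_pow, Int.negOnePow_even l (h1.2 hl), mul_one]
  · rw [hl.neg_pow, Int.negOnePow_odd l (h2.2 hl), mul_neg, mul_one, Units.val_neg, neg_smul, mul_neg, smul_neg,
      smul_neg, neg_neg]

theorem represents_inZ (b : PDO V) :
    Represents D (daggerZ (scalarOp V) (lamOp D) (derEnd D) b.toLaurent)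
      (inZ (lamSub (PDO.adjoint D b))) := by
  intro p q
  rw [daggerZ_eq, coef_lmap, coef_dagger_eq, inZ]
  refine (coef_lconst _ _).trans ?_
  split_ifs
  · rfl
  · simp

theorem represents_adlerRHS (a b : PDO V) :
    Represents D (adlerSer (scalarOp V) (lamOp D) (derEnd D) a.toLaurent b.toLaurent)
      (adlerRHS D a b) := by
  intro p q
  rw [adlerSer, mul_assoc, mul_assoc, coef_sub, coef_sub, adlerRHS, map_sub,
    ((represents_inZ b).iotaInv.shiftApply a) p q, ((represents_inW b).iotaInv.mulZ a) p q]

theorem represents_series (L : LambdaBracket D) (a b : PDO V) :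
    Represents D (L.toRingBracket.ser a.toLaurent b.toLaurent) (L.series a b) := by
  intro p q
  simp [LambdaBracket.series, LambdaBracket.toRingBracket_br]

theorem Represents.eq_iff {G G' : Laurent (Laurent (OpEnd V))} {g g' : ℤ → ℤ → V[X]}
    (hG : Represents D G g) (hG' : Represents D G' g') : G = G' ↔ g = g' := by
  constructor
  · rintro rfl
    funext p q
    exact polyOp_injective D (by rw [← hG, ← hG'])
  · rintro rfl
    exact coef_ext fun p => coef_ext fun q => by rw [hG, hG']

/-- Both sides of the identity have the same image under the injective `polyOp`, coefficient by
coefficient, so the condition can be moved to series over `E` and back. -/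
theorem isAdler_iff {m n : Type*} (L : LambdaBracket D) (A : Matrix m n (PDO V)) :
    IsAdler L A ↔ L.toRingBracket.IsAdlerSer fun i j => (A i j).toLaurent :=
  forall_congr' fun _ => forall_congr' fun _ => forall_congr' fun _ => forall_congr' fun _ =>
    ((represents_series L _ _).eq_iff (represents_adlerRHS _ _)).symm

theorem ser_eq_zero_iff (L : LambdaBracket D) (a b : PDO V) :
    L.toRingBracket.ser a.toLaurent b.toLaurent = 0 ↔ L.series a b = 0 :=
  (represents_series L a b).eq_iff fun p q => by simp

theorem toLaurent_matComp {m n p : Type*} [Fintype n] (A : Matrix m n (PDO V))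
    (B : Matrix n p (PDO V)) (i : m) (k : p) : (matComp D A B i k).toLaurent =
      ∑ j, opComp (derEnd D) (B j k).toLaurent (A i j).toLaurent := by
  simp [matComp, PDO.toLaurent_comp]

/-! ### Operations on matrices of Adler type -/

theorem IsAdler.adjoint {m n : Type*} {L : LambdaBracket D} {A : Matrix m n (PDO V)}
    (hA : IsAdler L A) : IsAdler L (matAdjoint D A) := by
  rw [isAdler_iff] at hA ⊢
  simpa only [matAdjoint, Matrix.of_apply, PDO.toLaurent_adjoint] using
    hA.adjoint (lamOp_mul_scalarOp D)

theorem IsAdler.comp {m n p : Type*} [Fintype n] {L : LambdaBracket D} {A : Matrix m n (PDO V)}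
    {B : Matrix n p (PDO V)} (hA : IsAdler L A) (hB : IsAdler L B)
    (h1 : ∀ i j h k, L.series (A i j) (B h k) = 0) (h2 : ∀ i j h k, L.series (B h k) (A i j) = 0) :
    IsAdler L (matComp D A B) := by
  rw [isAdler_iff] at hA hB ⊢
  simpa only [toLaurent_matComp] using hA.mul (lamOp_mul_scalarOp D) hB
    (fun i j h k => (ser_eq_zero_iff L _ _).2 (h1 i j h k))
    (fun i j h k => (ser_eq_zero_iff L _ _).2 (h2 i j h k))

theorem toLaurent_matConst_one {n : Type*} [DecidableEq n] (i j : n) :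
    (matConst V (1 : Matrix n n F) i j).toLaurent = if i = j then 1 else 0 := by
  rw [matConst, Matrix.of_apply, PDO.toLaurent_const, Matrix.one_apply]
  split_ifs <;> simp

theorem IsAdler.inverse {n : Type*} [Fintype n] [DecidableEq n] {L : LambdaBracket D}
    {A A' : Matrix n n (PDO V)} (hA : IsAdler L A)
    (h1 : matComp D A A' = matConst V (1 : Matrix n n F))
    (h2 : matComp D A' A = matConst V (1 : Matrix n n F)) : IsAdler L.opposite A' := by
  rw [isAdler_iff] at hA
  have h3 := hA.inverse (lamOp_mul_scalarOp D) (A' := fun i j => (A' i j).toLaurent)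
    (fun i k => by rw [← toLaurent_matComp, h1, toLaurent_matConst_one])
    (fun i k => by rw [← toLaurent_matComp, h2, toLaurent_matConst_one])
  intro i j h k
  funext p q
  have h4 := congrArg (fun G => coef (coef G p) q) (h3 i j h k)
  simp only [coef_neg] at h4
  rw [represents_series, represents_adlerRHS, ← map_neg] at h4
  have h5 := polyOp_injective D h4
  -- The sign moves to the bracket side, where it is the opposite bracket by definition.
  rw [eq_neg_iff_add_eq_zero, ← neg_eq_iff_add_eq_zero] at h5
  exact h5

theorem ser_algebraMap_left (L : LambdaBracket D) (c : F) (b : Laurent V) :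
    L.toRingBracket.ser (lconst (algebraMap F V c)) b = 0 := by
  have h : ∀ b, L.br 1 b = 0 := fun b =>
    polyOp_injective D (by rw [← L.toRingBracket_br, RingBracket.br_one_left, map_zero])
  refine coef_ext fun p => coef_ext fun q => ?_
  rw [RingBracket.coef_ser, coef_lconst]
  split_ifs
  · rw [L.toRingBracket_br, Algebra.algebraMap_eq_smul_one, map_smul, LinearMap.smul_apply, h,
      smul_zero, map_zero]
    rfl
  · rw [map_zero]
    rfl

theorem ser_algebraMap_right (L : LambdaBracket D) (a : Laurent V) (c : F) :
    L.toRingBracket.ser a (lconst (algebraMap F V c)) = 0 := by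
  have h : ∀ a, L.br a 1 = 0 := fun a =>
    polyOp_injective D (by rw [← L.toRingBracket_br, RingBracket.br_one_right, map_zero])
  refine coef_ext fun p => coef_ext fun q => ?_
  rw [RingBracket.coef_ser, coef_lconst]
  split_ifs
  · rw [L.toRingBracket_br, Algebra.algebraMap_eq_smul_one, map_smul, h, smul_zero, map_zero]
    rfl
  · rw [map_zero]
    rfl

theorem toLaurent_matConst {m n : Type*} (S : Matrix m n F) (i : m) (j : n) :
    (matConst V S i j).toLaurent = lconst (algebraMap F V (S i j)) :=
  PDO.toLaurent_const _

/-- Brackets with constants vanish by linearity and `{1, b} = 0`. On the other side the symbols of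
constants do not depend on their argument, so the two terms coincide. -/
theorem isAdler_matConst {m n : Type*} (L : LambdaBracket D) (S : Matrix m n F) :
    IsAdler L (matConst V S) := by
  rw [isAdler_iff]
  intro i j h k
  simp only [toLaurent_matConst, ser_algebraMap_left]
  rw [adlerSer, leftSymbol_lconst, dagger_lconst (lconst_mul_comm_rel (lamOp_mul_scalarOp D)),
    symb_lconst, symb_lconst]
  exact (sub_self _).symm

theorem series_matConst_left {m n : Type*} (L : LambdaBracket D) (S : Matrix m n F) (i : m) (j : n)
    (b : PDO V) : L.series (matConst V S i j) b = 0 := by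
  rw [← ser_eq_zero_iff, toLaurent_matConst, ser_algebraMap_left]

theorem series_matConst_right {m n : Type*} (L : LambdaBracket D) (S : Matrix m n F) (i : m)
    (j : n) (a : PDO V) : L.series a (matConst V S i j) = 0 := by
  rw [← ser_eq_zero_iff, toLaurent_matConst, ser_algebraMap_right]

end PDO

end AdlerType

end

/-! ### The proposition -/

theorem proposition3p3 {F V : Type*} [Field F] [CharZero F] [CommRing V] [Algebra F V]
    (D : Derivation F V V) (L : AdlerType.LambdaBracket D) :
    -- (a) submatrices; in particular, entries
    (∀ (M N : ℕ) (A : Matrix (Fin M) (Fin N) (AdlerType.PDO V)), AdlerType.IsAdler L A →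
      (∀ (I : Set (Fin M)) (J : Set (Fin N)),
        AdlerType.IsAdler L
          (A.submatrix (fun i : I => (i : Fin M)) (fun j : J => (j : Fin N)))) ∧
      (∀ (i : Fin M) (j : Fin N),
        AdlerType.IsAdler L (Matrix.of fun (_ _ : Fin 1) => A i j))) ∧
    -- (b) the formal adjoint
    (∀ (M N : ℕ) (A : Matrix (Fin M) (Fin N) (AdlerType.PDO V)), AdlerType.IsAdler L A →
      AdlerType.IsAdler L (AdlerType.matAdjoint D A)) ∧
    -- (c) the inverse, with respect to the opposite bracket
    (∀ (N : ℕ) (A A' : Matrix (Fin N) (Fin N) (AdlerType.PDO V)), AdlerType.IsAdler L A →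
      AdlerType.matComp D A A' = AdlerType.matConst V (1 : Matrix (Fin N) (Fin N) F) →
      AdlerType.matComp D A' A = AdlerType.matConst V (1 : Matrix (Fin N) (Fin N) F) →
      AdlerType.IsAdler L.opposite A') ∧
    -- (d) products
    (∀ (M N P : ℕ) (A : Matrix (Fin M) (Fin N) (AdlerType.PDO V))
      (B : Matrix (Fin N) (Fin P) (AdlerType.PDO V)),
      AdlerType.IsAdler L A → AdlerType.IsAdler L B →
      (∀ i j h k, L.series (A i j) (B h k) = 0) →
      (∀ i j h k, L.series (B h k) (A i j) = 0) →
      AdlerType.IsAdler L (AdlerType.matComp D A B)) ∧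
    (∀ (M N P Q : ℕ) (A : Matrix (Fin M) (Fin N) (AdlerType.PDO V)), AdlerType.IsAdler L A →
      ∀ (S : Matrix (Fin P) (Fin M) F) (T : Matrix (Fin N) (Fin Q) F),
      AdlerType.IsAdler L
        (AdlerType.matComp D (AdlerType.matComp D (AdlerType.matConst V S) A)
          (AdlerType.matConst V T))) := by
  refine ⟨fun M N A hA => ⟨fun I J i j h k => hA i j h k, fun i j _ _ _ _ => hA i j i j⟩,
    fun M N A hA => hA.adjoint, fun N A A' hA h1 h2 => hA.inverse h1 h2,
    fun M N P A B hA hB h1 h2 => hA.comp hB h1 h2, fun M N P Q A hA S T => ?_⟩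
  -- `S A T` is a product of Adler matrices, since constants are of Adler type and have zero bracket
  -- with everything.
  exact ((AdlerType.isAdler_matConst L S).comp hA
    (fun _ _ _ _ => AdlerType.series_matConst_left L S _ _ _)
    (fun _ _ _ _ => AdlerType.series_matConst_right L S _ _ _)).comp
    (AdlerType.isAdler_matConst L T) (fun _ _ _ _ => AdlerType.series_matConst_right L T _ _ _)
    (fun _ _ _ _ => AdlerType.series_matConst_left L T _ _ _)
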